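/- **Theorem.** Let $n\ge 1$ and let $H=([n],E)$ be a hypergraph on $[n]=\{1,\dots,n\}$ all of whose edges have at least two elements and no edge of which is properly contained in another. *Definitions.* Order the ordered set partitions $B_1|\cdots|B_r$ of $[n]$ (without empty blocks) by letting $B$ cover the partitions obtained from it by uniting two adjacent blocks. Let $\Sigma_n$ be the simplicial complex whose $(r-2)$-dimensional faces are all the ordered set partitions $B_1|\cdots|B_r$ of $[n]$, with containment of faces given by this order, and let the hypergraph coloring complex $\Delta_H\subseteq\Sigma_n$ consist of those faces $B_1|\cdots|B_r$ for which some block $B_i$ contains an edge of $H$. Let $K_n$ be the complete graph on $[n]$, regarded as a hypergraph with the two-element subsets as edges. Let $I_H\subseteq\mathbb{R}[x_1,\dots,x_n]$ be the edge ideal, generated by the monomials $\prod_{i\in F}x_i$, $F\in E$, and let $\mathcal{A}_H$ be its canonical arrangement: the collection of the subspaces $\{u : u_{i_1}=\cdots=u_{i_s},\ u_1+\cdots+u_n=0\}$ of $\mathbb{R}^n$, one for each square-free minimal monomial generator $x_{i_1}\cdots x_{i_s}$ of $I_H$ (we also write $\mathcal{A}_H$ for their union). Let $S^{n-2}$ be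 the unit sphere of the hyperplane $\{u\in\mathbb{R}^n : u_1+\cdots+u_n=0\}$. The braid arrangement $\mathcal{A}_n=\{\{u_i=u_j\} : i\ne j\}$ subdivides $S^{n-2}$ into cells, the intersections of $S^{n-2}$ with the closed faces of $\mathcal{A}_n$; the restriction of this subdivision to $\mathcal{A}_H$ consists of the cells that are contained in $\mathcal{A}_H$. *Claims.* 1. The cells of the restriction of the subdivision $\mathcal{A}_n\cap S^{n-2}$ to $\mathcal{A}_H$ are spherical simplices, and the simplicial complex they form is isomorphic to $\Delta_H$. 2. $\Sigma_n$ is simplicially isomorphic to the barycentric subdivision of the boundary of the $(n-1)$-simplex, $\Delta_H\subseteq\Delta_{K_n}\subseteq\Sigma_n$, and there is a homeomorphism from (the geometric realization of) $\Sigma_n$ onto $S^{n-2}$ that maps $\Delta_H$ onto $S^{n-2}\cap\mathcal{A}_H$ and $\Delta_{K_n}$ onto $S^{n-2}\cap\mathcal{A}_{K_n}$. In particular the pair $(\Sigma_n,\Delta_H)$ is homeomorphic to the pair $(S^{n-2},S^{n-2}\cap\mathcal{A}_H)$, and the pair $(\Delta_{K_n},\Delta_H)$ to the pair $(S^{n-2}\cap\mathcal{A}_{K_n},S^{n-2}\cap\mathcal{A}_H)$.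 -/

import Mathlib

/-! ### Ordered set partitions -/

/-- An ordered set partition `B₁|B₂|⋯|B_r` of the `n`-element set `Fin n`, without empty blocks. -/
@[ext]
structure OrderedSetPartition (n : ℕ) where
  blocks : List (Finset (Fin n))
  nonempty_of_mem : ∀ b ∈ blocks, b.Nonempty
  disjoint : blocks.Pairwise Disjoint
  cover : ∀ i : Fin n, ∃ b ∈ blocks, i ∈ b

namespace OrderedSetPartition

/-- `B'` arises from `B` by taking the union of two adjacent blocks. -/
def Merges {n : ℕ} (B' B : OrderedSetPartition n) : Prop :=
  ∃ (l₁ l₂ : List (Finset (Fin n))) (x y : Finset (Fin n)),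
    B.blocks = l₁ ++ x :: y :: l₂ ∧ B'.blocks = l₁ ++ (x ∪ y) :: l₂

/-- The order on ordered set partitions generated by: `B` lies above every partition that is
obtained from it by uniting two adjacent blocks. -/
instance (n : ℕ) : Preorder (OrderedSetPartition n) where
  le := Relation.ReflTransGen Merges
  le_refl _ := Relation.ReflTransGen.refl
  le_trans _ _ _ := Relation.ReflTransGen.trans

/-- The ordered set partitions with exactly two blocks. -/
abbrev TwoBlock (n : ℕ) : Type := {v : OrderedSetPartition n // v.blocks.length = 2}

/-- The union of a list of blocks. -/
def union {n : ℕ} (l : List (Finset (Fin n))) : Finset (Fin n) := l.foldr (· ∪ ·) ∅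

theorem union_append {n : ℕ} (l m : List (Finset (Fin n))) :
    union (l ++ m) = union l ∪ union m := by
  induction l with
  | nil => simp [union]
  | cons a l ih =>
    have h : ∀ (a : Finset (Fin n)) l, union (a :: l) = a ∪ union l := fun _ _ => rfl
    rw [List.cons_append, h, h, ih, Finset.union_assoc]

theorem union_cons {n : ℕ} (a : Finset (Fin n)) (l : List (Finset (Fin n))) :
    union (a :: l) = a ∪ union l := rfl

theorem mem_union {n : ℕ} {l : List (Finset (Fin n))} {i : Fin n} :
    i ∈ union l ↔ ∃ b ∈ l, i ∈ b := by
  induction l with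
  | nil => simp [union]
  | cons a l ih => simp [union_cons, ih]

/-- The partition obtained by uniting two given adjacent blocks. -/
def merge {n : ℕ} (B : OrderedSetPartition n) (l₁ l₂ : List (Finset (Fin n)))
    (x y : Finset (Fin n)) (h : B.blocks = l₁ ++ x :: y :: l₂) : OrderedSetPartition n where
  blocks := l₁ ++ (x ∪ y) :: l₂
  nonempty_of_mem := by
    intro b hb
    have H := B.nonempty_of_mem
    rw [h] at H
    simp only [List.mem_append, List.mem_cons] at hb H
    rcases hb with hb | rfl | hb
    · exact H b (Or.inl hb)
    · exact (H x (Or.inr (Or.inl rfl))).mono Finset.subset_union_left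
    · exact H b (Or.inr (Or.inr (Or.inr hb)))
  disjoint := by
    have H := B.disjoint
    rw [h] at H
    simp only [List.pairwise_append, List.pairwise_cons, List.mem_cons] at H ⊢
    obtain ⟨h1, ⟨h2, h3, h4⟩, h5⟩ := H
    refine ⟨h1, ⟨fun a ha => ?_, h4⟩, fun a ha b hb => ?_⟩
    · exact Finset.disjoint_union_left.2 ⟨h2 a (Or.inr ha), h3 a ha⟩
    · rcases hb with rfl | hb
      · exact Finset.disjoint_union_right.2
          ⟨h5 a ha x (Or.inl rfl), h5 a ha y (Or.inr (Or.inl rfl))⟩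
      · exact h5 a ha b (Or.inr (Or.inr hb))
  cover := by
    intro i
    obtain ⟨b, hb, hi⟩ := B.cover i
    rw [h] at hb
    simp only [List.mem_append, List.mem_cons] at hb ⊢
    rcases hb with hb | rfl | rfl | hb
    · exact ⟨b, Or.inl hb, hi⟩
    · exact ⟨_, Or.inr (Or.inl rfl), Finset.mem_union_left _ hi⟩
    · exact ⟨_, Or.inr (Or.inl rfl), Finset.mem_union_right _ hi⟩
    · exact ⟨b, Or.inr (Or.inr hb), hi⟩

theorem merge_le {n : ℕ} (B : OrderedSetPartition n) (l₁ l₂ : List (Finset (Fin n)))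
    (x y : Finset (Fin n)) (h : B.blocks = l₁ ++ x :: y :: l₂) : B.merge l₁ l₂ x y h ≤ B :=
  Relation.ReflTransGen.single ⟨l₁, l₂, x, y, h, rfl⟩

theorem exists_split_of_le {n : ℕ} {v B : OrderedSetPartition n} (hv : v.blocks.length = 2)
    (h : v ≤ B) : ∃ p q, p ≠ [] ∧ q ≠ [] ∧ B.blocks = p ++ q ∧ v.blocks = [union p, union q] := by
  change Relation.ReflTransGen Merges v B at h
  induction h with
  | refl =>
    obtain ⟨a, b, hab⟩ := List.length_eq_two.1 hv
    exact ⟨[a], [b], by simp, by simp, by simp [hab], by simp [hab, union]⟩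
  | @tail C D _ hm ih =>
    obtain ⟨p, q, hp, hq, hC, hvb⟩ := ih
    obtain ⟨l₁, l₂, x, y, hD, hC'⟩ := hm
    rw [hC] at hC'
    rcases List.append_eq_append_iff.1 hC' with ⟨a, h1, h2⟩ | ⟨a, h1, h2⟩
    · refine ⟨p, a ++ x :: y :: l₂, hp, by simp, by simp [hD, h1], ?_⟩
      rw [hvb, h2]
      simp [union_append, union_cons, Finset.union_assoc]
    · cases a with
      | nil =>
        simp only [List.append_nil, List.nil_append] at h1 h2
        subst h1
        refine ⟨p, x :: y :: l₂, hp, by simp, hD, ?_⟩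
        rw [hvb, ← h2]
        simp [union_cons, Finset.union_assoc]
      | cons c a =>
        simp only [List.cons_append, List.cons.injEq] at h2
        obtain ⟨rfl, rfl⟩ := h2
        refine ⟨l₁ ++ x :: y :: a, q, by simp, hq, by simp [hD], ?_⟩
        rw [hvb, h1]
        simp [union_append, union_cons, Finset.union_assoc]

theorem le_of_split {n : ℕ} {v : OrderedSetPartition n} :
    ∀ (k : ℕ) (B : OrderedSetPartition n) (p q : List (Finset (Fin n))),
      B.blocks.length = k → p ≠ [] → q ≠ [] → B.blocks = p ++ q →
      v.blocks = [union p, union q] → v ≤ B := by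
  intro k
  induction k with
  | zero =>
    intro B p q hk hp hq hB hv
    rw [List.length_eq_zero_iff, hB] at hk
    simp_all
  | succ k ih =>
    intro B p q hk hp hq hB hv
    match p, q, hp, hq with
    | [a], [b], _, _ =>
      have : v = B := by
        ext1
        rw [hv, hB]; simp [union]
      exact this.le
    | a :: a' :: p, q, _, hq =>
      refine le_trans (ih (B.merge [] (p ++ q) a a' (by simp [hB])) ((a ∪ a') :: p) q ?_
        (by simp) hq (by simp [merge]) ?_) (merge_le _ _ _ _ _ _)
      · simp only [hB, merge, List.length_append, List.length_cons, List.nil_append] at hk ⊢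
        omega
      · rw [hv]; simp [union_cons, Finset.union_assoc]
    | [a], b :: b' :: q, _, _ =>
      refine le_trans (ih (B.merge [a] q b b' (by simp [hB])) [a] ((b ∪ b') :: q) ?_
        (by simp) (by simp) (by simp [merge]) ?_) (merge_le _ _ _ _ _ _)
      · simp only [hB, merge, List.length_append, List.length_cons, List.length_nil] at hk ⊢
        omega
      · rw [hv]; simp [union_cons, Finset.union_assoc]

/-- Forgetting one vertex of a partition amounts to uniting two adjacent blocks. -/
theorem exists_erase {n : ℕ} {B v : OrderedSetPartition n} (hv : v.blocks.length = 2)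
    (h : v ≤ B) : ∃ C ≤ B, ∀ w : OrderedSetPartition n, w.blocks.length = 2 →
      (w ≤ C ↔ w ≤ B ∧ w ≠ v) := by
  obtain ⟨p, q, hp, hq, hB, hvb⟩ := exists_split_of_le hv h
  obtain ⟨p, x, rfl⟩ := (List.eq_nil_or_concat p).resolve_left hp
  obtain ⟨y, q, rfl⟩ := List.exists_cons_of_ne_nil hq
  rw [List.concat_eq_append] at *
  have hB' : B.blocks = p ++ x :: y :: q := by simp [hB]
  refine ⟨B.merge p q x y hB', merge_le _ _ _ _ _ _, fun w hw => ⟨fun hwC => ?_, ?_⟩⟩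
  · refine ⟨hwC.trans (merge_le _ _ _ _ _ _), ?_⟩
    rintro rfl
    obtain ⟨p', q', hp', hq', hC, hwb⟩ := exists_split_of_le hw hwC
    have hd := B.disjoint
    rw [hB'] at hd
    simp only [List.pairwise_append, List.pairwise_cons, List.mem_cons] at hd
    obtain ⟨_, ⟨hxy, hy, _⟩, hpd⟩ := hd
    obtain ⟨i, hi⟩ := B.nonempty_of_mem x (by simp [hB'])
    obtain ⟨j, hj⟩ := B.nonempty_of_mem y (by simp [hB'])
    rw [hwb] at hvb
    simp only [List.cons.injEq, and_true] at hvb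
    obtain ⟨e1, e2⟩ := hvb
    have hip : i ∈ union p' := by
      rw [e1, mem_union]; exact ⟨x, by simp, hi⟩
    have hjp : j ∈ union q' := by
      rw [e2, mem_union]; exact ⟨y, by simp, hj⟩
    have hdC := (B.merge p q x y hB').disjoint
    rw [hC, List.pairwise_append] at hdC
    have hmem : x ∪ y ∈ p' ++ q' := by rw [← hC]; simp [merge]
    rw [mem_union] at hip hjp
    obtain ⟨b, hb, hib⟩ := hip
    obtain ⟨c, hc, hjc⟩ := hjp
    rcases List.mem_append.1 hmem with hm | hm
    · exact Finset.disjoint_left.1 (hdC.2.2 _ hm _ hc) (Finset.mem_union_right _ hj) hjc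
    · exact Finset.disjoint_left.1 (hdC.2.2 _ hb _ hm) hib (Finset.mem_union_left _ hi)
  · rintro ⟨hwB, hne⟩
    obtain ⟨p', q', hp', hq', hB2, hwb⟩ := exists_split_of_le hw hwB
    rw [hB2] at hB'
    have hcase : (∃ a, p = p' ++ a ∧ q' = a ++ x :: y :: q) ∨
        (∃ a, p' = p ++ x :: y :: a ∧ q = a ++ q') ∨ (p' = p ++ [x] ∧ q' = y :: q) := by
      rcases List.append_eq_append_iff.1 hB' with ⟨a, h1, h2⟩ | ⟨a, h1, h2⟩
      · exact Or.inl ⟨a, h1, h2⟩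
      · match a, h1, h2 with
        | [], h1, h2 => exact Or.inl ⟨[], by simp [h1], by simpa using h2.symm⟩
        | [c], h1, h2 =>
          simp only [List.cons_append, List.nil_append, List.cons.injEq] at h2
          exact Or.inr (Or.inr ⟨by rw [h1, h2.1], h2.2.symm⟩)
        | c :: d :: a, h1, h2 =>
          simp only [List.cons_append, List.cons.injEq] at h2
          exact Or.inr (Or.inl ⟨a, by rw [h1, h2.1, h2.2.1], h2.2.2⟩)
    rcases hcase with ⟨a, rfl, rfl⟩ | ⟨a, rfl, rfl⟩ | ⟨rfl, rfl⟩
    · refine le_of_split _ _ p' (a ++ (x ∪ y) :: q) rfl hp' (by simp) (by simp [merge]) ?_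
      rw [hwb]; simp [union_append, union_cons, Finset.union_assoc]
    · refine le_of_split _ _ (p ++ (x ∪ y) :: a) q' rfl (by simp) hq' (by simp [merge]) ?_
      rw [hwb]; simp [union_append, union_cons, Finset.union_assoc]
    · exact absurd (OrderedSetPartition.ext (hwb.trans hvb.symm)) hne

end OrderedSetPartition

open OrderedSetPartition in
/-- The simplicial complex whose faces are the ordered set partitions in a lower set `I`, contained
in each other according to the order on ordered set partitions. A face `B₁|⋯|B_r` is encoded by its
set of vertices, the `r - 1` two-block partitions below it; the one-block partition is the empty
face, which `PreAbstractSimplicialComplex` does not list. -/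
def partitionComplex {n : ℕ} (I : LowerSet (OrderedSetPartition n)) :
    PreAbstractSimplicialComplex (TwoBlock n) where
  faces := {s | s.Nonempty ∧ ∃ B ∈ I, ∀ v : TwoBlock n, v ∈ s ↔ v.1 ≤ B}
  isRelLowerSet_faces := by
    classical
    rintro s ⟨hs, hB⟩
    refine ⟨hs, fun t hts ht => ⟨ht, ?_⟩⟩
    obtain ⟨k, hk⟩ : ∃ k, (s \ t).card = k := ⟨_, rfl⟩
    induction k generalizing s with
    | zero =>
      have : s = t := Finset.Subset.antisymm
        (Finset.sdiff_eq_empty_iff_subset.1 (Finset.card_eq_zero.1 hk)) hts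
      exact this ▸ hB
    | succ k ih =>
      obtain ⟨v, hv⟩ : (s \ t).Nonempty := Finset.card_pos.1 (by omega)
      obtain ⟨hvs, hvt⟩ := Finset.mem_sdiff.1 hv
      obtain ⟨B, hBI, hB⟩ := hB
      obtain ⟨C, hCB, hC⟩ := exists_erase v.2 ((hB v).1 hvs)
      have hsub : t ⊆ s.erase v := fun w hw =>
        Finset.mem_erase.2 ⟨fun h => hvt (h ▸ hw), hts hw⟩
      refine ih (s := s.erase v) (ht.mono hsub)
        ⟨C, I.lower hCB hBI, fun w => ?_⟩ hsub ?_
      · rw [hC w.1 w.2, Finset.mem_erase, hB w, and_comm, Ne, Ne, Subtype.ext_iff]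
      · rw [Finset.erase_sdiff_comm, Finset.card_erase_of_mem hv, hk]; rfl

/-- The complex of all ordered set partitions. -/
def orderedPartitionComplex (n : ℕ) :
    PreAbstractSimplicialComplex (OrderedSetPartition.TwoBlock n) :=
  partitionComplex ⊤

/-- The barycentric subdivision of the boundary of the simplex with vertex set `Fin n`: its faces
are the chains of nonempty proper subsets. -/
def sdBoundarySimplex (n : ℕ) : PreAbstractSimplicialComplex (Finset (Fin n)) where
  faces := {s | s.Nonempty ∧ (∀ A ∈ s, A.Nonempty ∧ A ≠ Finset.univ) ∧
    IsChain (· ⊆ ·) (s : Set (Finset (Fin n)))}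
  isRelLowerSet_faces := by
    rintro s ⟨hs, h1, h2⟩
    exact ⟨hs, fun t hts ht =>
      ⟨ht, fun A hA => h1 A (hts hA), h2.mono (Finset.coe_subset.2 hts)⟩⟩

/-! ### The coloring complex of a hypergraph -/

/-- The ordered set partitions having a block that contains an edge of `H`. -/
def coloringIdeal {n : ℕ} (H : Hypergraph (Fin n)) : LowerSet (OrderedSetPartition n) where
  carrier := {B | ∃ b ∈ B.blocks, ∃ e ∈ H.edgeSet, e ⊆ (b : Set (Fin n))}
  lower' := by
    intro B C hCB hB
    change Relation.ReflTransGen OrderedSetPartition.Merges C B at hCB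
    induction hCB with
    | refl => exact hB
    | tail _ hm ih =>
      obtain ⟨l₁, l₂, x, y, hD, hC⟩ := hm
      obtain ⟨b, hb, e, he, heb⟩ := hB
      apply ih
      rw [hD] at hb
      simp only [List.mem_append, List.mem_cons] at hb
      simp only [Set.mem_ofPred_eq, hC, List.mem_append, List.mem_cons]
      rcases hb with hb | rfl | rfl | hb
      · exact ⟨b, Or.inl hb, e, he, heb⟩
      · exact ⟨_, Or.inr (Or.inl rfl), e, he,
          heb.trans (Finset.coe_subset.2 Finset.subset_union_left)⟩
      · exact ⟨_, Or.inr (Or.inl rfl), e, he,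
          heb.trans (Finset.coe_subset.2 Finset.subset_union_right)⟩
      · exact ⟨b, Or.inr (Or.inr hb), e, he, heb⟩

/-- The hypergraph coloring complex: its faces are the ordered set partitions having a block that
contains an edge. -/
def coloringComplex {n : ℕ} (H : Hypergraph (Fin n)) :
    PreAbstractSimplicialComplex (OrderedSetPartition.TwoBlock n) :=
  partitionComplex (coloringIdeal H)

/-- The complete graph on `Fin n`, as a hypergraph. -/
def completeGraphHypergraph (n : ℕ) : Hypergraph (Fin n) where
  vertexSet := Set.univ
  edgeSet := {e | e.ncard = 2}
  subset_vertexSet_of_mem_edgeSet' := fun _ _ => Set.subset_univ _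

/-! ### Isomorphism and geometric realization of simplicial complexes -/

/-- The vertices of a simplicial complex. -/
abbrev PreAbstractSimplicialComplex.Vertex {α : Type*} (K : PreAbstractSimplicialComplex α) :
    Type _ := {v : α // {v} ∈ K.faces}

/-- Two simplicial complexes are isomorphic: there is a bijection between their vertices under
which the faces correspond to each other. -/
def SimpliciallyIsomorphic {α β : Type*} (K : PreAbstractSimplicialComplex α)
    (L : PreAbstractSimplicialComplex β) : Prop :=
  ∃ φ : K.Vertex ≃ L.Vertex, ∀ s : Finset K.Vertex,
    s.map (Function.Embedding.subtype _) ∈ K.faces ↔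
      (s.map φ.toEmbedding).map (Function.Embedding.subtype _) ∈ L.faces

/-- The geometric realization of a simplicial complex with finitely many vertices, in barycentric
coordinates, with the topology induced from `α → ℝ`. -/
def geometricRealization {α : Type*} (K : PreAbstractSimplicialComplex α) : Set (α → ℝ) :=
  {w | ∃ s ∈ K.faces, (∀ v, 0 ≤ w v) ∧ (∀ v ∉ s, w v = 0) ∧ ∑ v ∈ s, w v = 1}

/-! ### The edge ideal and its canonical arrangement -/

/-- The square-free monomial `x^A`. -/
noncomputable def squarefreeMonomial {n : ℕ} (A : Finset (Fin n)) : MvPolynomial (Fin n) ℝ :=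
  ∏ i ∈ A, MvPolynomial.X i

/-- The edge ideal of a hypergraph. -/
noncomputable def edgeIdeal {n : ℕ} (H : Hypergraph (Fin n)) : Ideal (MvPolynomial (Fin n) ℝ) :=
  Ideal.span {m | ∃ F : Finset (Fin n), (F : Set (Fin n)) ∈ H.edgeSet ∧ m = squarefreeMonomial F}

/-- `x^A` is a minimal generator of the monomial ideal `J`: it lies in `J`, but none of its proper
monomial divisors (which are the `x^B` with `B ⊂ A`) does. -/
def IsSquarefreeMinimalGenerator {n : ℕ} (J : Ideal (MvPolynomial (Fin n) ℝ))
    (A : Finset (Fin n)) : Prop :=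
  squarefreeMonomial A ∈ J ∧ ∀ B, B ⊂ A → squarefreeMonomial B ∉ J

/-- The hyperplane `u₁ + ⋯ + u_n = 0`. -/
def sumZeroHyperplane (n : ℕ) : Submodule ℝ (EuclideanSpace ℝ (Fin n)) where
  carrier := {u | ∑ i, u i = 0}
  add_mem' := by
    intro a b ha hb
    simp only [Set.mem_ofPred_eq, PiLp.add_apply, Finset.sum_add_distrib] at *
    rw [ha, hb, add_zero]
  zero_mem' := by simp
  smul_mem' := by
    intro c a ha
    simp only [Set.mem_ofPred_eq, PiLp.smul_apply, smul_eq_mul, ← Finset.mul_sum] at *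
    rw [ha, mul_zero]

/-- The subspace on which all coordinates with index in `A` agree. -/
def diagonalSubspace {n : ℕ} (A : Finset (Fin n)) : Submodule ℝ (EuclideanSpace ℝ (Fin n)) where
  carrier := {u | ∀ i ∈ A, ∀ j ∈ A, u i = u j}
  add_mem' := by
    intro a b ha hb i hi j hj
    simp only [PiLp.add_apply]
    rw [ha i hi j hj, hb i hi j hj]
  zero_mem' := by simp
  smul_mem' := by
    intro c a ha i hi j hj
    simp only [PiLp.smul_apply]
    rw [ha i hi j hj]

/-- The canonical arrangement of a monomial ideal: the collection of the subspaces belonging to its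
square-free minimal generators, intersected with the sum-zero hyperplane. -/
def canonicalArrangement {n : ℕ} (J : Ideal (MvPolynomial (Fin n) ℝ)) :
    Set (Submodule ℝ (EuclideanSpace ℝ (Fin n))) :=
  {W | ∃ A, IsSquarefreeMinimalGenerator J A ∧ W = diagonalSubspace A ⊓ sumZeroHyperplane n}

/-- The union of the subspaces of the canonical arrangement of the edge ideal of `H`. -/
def hypergraphArrangement {n : ℕ} (H : Hypergraph (Fin n)) : Set (EuclideanSpace ℝ (Fin n)) :=
  ⋃ W ∈ canonicalArrangement (edgeIdeal H), (W : Set (EuclideanSpace ℝ (Fin n)))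

/-! ### The subdivision of the sphere by the braid arrangement -/

/-- The unit sphere (of dimension `n - 2`) in the sum-zero hyperplane. -/
def sumZeroSphere (n : ℕ) : Set (EuclideanSpace ℝ (Fin n)) :=
  {u | u ∈ sumZeroHyperplane n ∧ ‖u‖ = 1}

/-- The closed face of the braid arrangement that has `x` in its relative interior: the points
that lie, for every hyperplane `u i = u j`, on the hyperplane if `x` does, and otherwise in the
closed half-space bounded by it that contains `x`. -/
def braidFace {n : ℕ} (x : EuclideanSpace ℝ (Fin n)) : Set (EuclideanSpace ℝ (Fin n)) :=
  {y | ∀ i j, (x i = x j → y i = y j) ∧ (x i < x j → y i ≤ y j)}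

/-- The nonempty closed cells of the subdivision of the sphere by the braid arrangement. -/
def braidCells (n : ℕ) : Set (Set (EuclideanSpace ℝ (Fin n))) :=
  {C | ∃ x ∈ sumZeroSphere n, C = braidFace x ∩ sumZeroSphere n}

/-- The points of the sphere that are nonnegative linear combinations of the points in `s`. -/
def sphericalHull {n : ℕ} (s : Finset (EuclideanSpace ℝ (Fin n))) :
    Set (EuclideanSpace ℝ (Fin n)) :=
  {y | y ∈ sumZeroSphere n ∧
    ∃ c : EuclideanSpace ℝ (Fin n) → ℝ, (∀ v ∈ s, 0 ≤ c v) ∧ y = ∑ v ∈ s, c v • v}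

/-- `C` is the spherical simplex with vertex set `s`. -/
def IsSphericalSimplex {n : ℕ} (s : Finset (EuclideanSpace ℝ (Fin n)))
    (C : Set (EuclideanSpace ℝ (Fin n))) : Prop :=
  s.Nonempty ∧ (∀ v ∈ s, v ∈ sumZeroSphere n) ∧
    LinearIndepOn ℝ id (s : Set (EuclideanSpace ℝ (Fin n))) ∧ C = sphericalHull s

theorem braidFace_subset {n : ℕ} {x x' : EuclideanSpace ℝ (Fin n)} (h : x' ∈ braidFace x) :
    braidFace x' ⊆ braidFace x := by
  intro y hy i j
  refine ⟨fun hij => (hy i j).1 ((h i j).1 hij), fun hij => ?_⟩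
  rcases ((h i j).2 hij).lt_or_eq with h' | h'
  · exact (hy i j).2 h'
  · exact ((hy i j).1 h').le

theorem smul_mem_braidFace {n : ℕ} {x y : EuclideanSpace ℝ (Fin n)} {c : ℝ} (hc : 0 ≤ c)
    (h : y ∈ braidFace x) : c • y ∈ braidFace x := by
  intro i j
  simp only [PiLp.smul_apply, smul_eq_mul]
  exact ⟨fun hij => by rw [(h i j).1 hij],
    fun hij => mul_le_mul_of_nonneg_left ((h i j).2 hij) hc⟩

theorem sum_mem_braidFace {n : ℕ} {x : EuclideanSpace ℝ (Fin n)}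
    {s : Finset (EuclideanSpace ℝ (Fin n))} {c : EuclideanSpace ℝ (Fin n) → ℝ}
    (hc : ∀ v ∈ s, 0 ≤ c v) (h : ∀ v ∈ s, v ∈ braidFace x) :
    ∑ v ∈ s, c v • v ∈ braidFace x := by
  intro i j
  simp only [WithLp.ofLp_sum, Finset.sum_apply, PiLp.smul_apply, smul_eq_mul]
  exact ⟨fun hij => Finset.sum_congr rfl fun v hv => by rw [(h v hv i j).1 hij],
    fun hij => Finset.sum_le_sum fun v hv =>
      mul_le_mul_of_nonneg_left ((h v hv i j).2 hij) (hc v hv)⟩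

theorem exists_coeff {n : ℕ} {x z : EuclideanSpace ℝ (Fin n)}
    {s : Finset (EuclideanSpace ℝ (Fin n))} (hs : braidFace x ∩ sumZeroSphere n = sphericalHull s)
    (hz : z ∈ braidFace x) (hz0 : z ∈ sumZeroHyperplane n) :
    ∃ c : EuclideanSpace ℝ (Fin n) → ℝ, (∀ v ∈ s, 0 ≤ c v) ∧ z = ∑ v ∈ s, c v • v := by
  by_cases h : z = 0
  · exact ⟨fun _ => 0, fun _ _ => le_rfl, by simp [h]⟩
  · have hn : ‖z‖ ≠ 0 := norm_ne_zero_iff.2 h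
    have hmem : ‖z‖⁻¹ • z ∈ sphericalHull s := by
      rw [← hs]
      refine ⟨smul_mem_braidFace (by positivity) hz, (sumZeroHyperplane n).smul_mem _ hz0, ?_⟩
      rw [norm_smul, norm_inv, norm_norm, inv_mul_cancel₀ hn]
    obtain ⟨_, c, hc, he⟩ := hmem
    refine ⟨fun v => ‖z‖ * c v, fun v hv => mul_nonneg (norm_nonneg _) (hc v hv), ?_⟩
    simp only [mul_smul]
    rw [← Finset.smul_sum, ← he, smul_smul, mul_inv_cancel₀ hn, one_smul]

/-- A face of a simplicial cell of the braid subdivision is again a cell. -/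
theorem sphericalHull_mem_braidCells {n : ℕ} {s t : Finset (EuclideanSpace ℝ (Fin n))}
    (hS : ∀ v ∈ s, v ∈ sumZeroSphere n)
    (hli : LinearIndepOn ℝ id (s : Set (EuclideanSpace ℝ (Fin n))))
    (hcell : sphericalHull s ∈ braidCells n) (hts : t ⊆ s) (ht : t.Nonempty) :
    sphericalHull t ∈ braidCells n := by
  classical
  obtain ⟨x, hx, hs⟩ := hcell
  have hs' := hs.symm
  have hvx : ∀ v ∈ s, v ∈ braidFace x := by
    intro v hv
    have : v ∈ sphericalHull s := ⟨hS v hv, fun w => if w = v then 1 else 0,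
      fun w _ => by dsimp only; split_ifs <;> norm_num, by simp [hv]⟩
    rw [hs] at this
    exact this.1
  have hli' := linearIndepOn_finset_iff.1 hli
  obtain ⟨x₀, hx₀⟩ : ∃ x₀, x₀ = ∑ v ∈ t, v := ⟨_, rfl⟩
  have hx₀s : x₀ = ∑ v ∈ s, (if v ∈ t then (1 : ℝ) else 0) • v := by
    rw [hx₀]
    simp only [ite_smul, one_smul, zero_smul]
    rw [← Finset.sum_filter, Finset.filter_mem_eq_inter, Finset.inter_eq_right.2 hts]
  have hne : x₀ ≠ 0 := by
    intro h0
    obtain ⟨v, hv⟩ := ht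
    have := hli' (fun v => if v ∈ t then (1 : ℝ) else 0) (by simpa [h0] using hx₀s.symm) v (hts hv)
    simp [hv] at this
  have hn : 0 < ‖x₀‖ := norm_pos_iff.2 hne
  have hx₀z : x₀ ∈ sumZeroHyperplane n := by
    rw [hx₀]; exact Submodule.sum_mem _ fun v hv => (hS v (hts hv)).1
  have hx₀x : x₀ ∈ braidFace x := by
    rw [hx₀s]
    exact sum_mem_braidFace (fun v _ => by split_ifs <;> norm_num) hvx
  have hface : braidFace (‖x₀‖⁻¹ • x₀) = braidFace x₀ := by
    have hi : 0 < ‖x₀‖⁻¹ := inv_pos.2 hn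
    ext y
    simp only [braidFace, Set.mem_ofPred_eq, PiLp.smul_apply, smul_eq_mul,
      mul_right_inj' hi.ne', mul_lt_mul_iff_right₀ hi]
  have hvx₀ : ∀ v ∈ t, v ∈ braidFace x₀ := by
    intro v hv i j
    have hcoord : ∀ k, x₀ k = ∑ w ∈ t, w k := by
      intro k; rw [hx₀]; simp
    have key : ∀ i j, x i ≤ x j → v i ≤ v j ∧ (x₀ j ≤ x₀ i → v j ≤ v i) := by
      intro i j hij
      have hle : ∀ w ∈ t, w i ≤ w j := by
        intro w hw
        rcases hij.lt_or_eq with h | h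
        · exact (hvx w (hts hw) i j).2 h
        · exact ((hvx w (hts hw) i j).1 h).le
      refine ⟨hle v hv, fun h => ?_⟩
      by_contra hlt
      have : ∑ w ∈ t, w i < ∑ w ∈ t, w j :=
        Finset.sum_lt_sum hle ⟨v, hv, not_le.1 hlt⟩
      rw [← hcoord, ← hcoord] at this
      exact absurd h (not_le.2 this)
    have key' : ∀ i j, x₀ i ≤ x₀ j → v i ≤ v j := by
      intro i j hij
      rcases le_total (x i) (x j) with h | h
      · exact (key i j h).1
      · exact (key j i h).2 hij
    exact ⟨fun h => le_antisymm (key' i j h.le) (key' j i h.ge), fun h => key' i j h.le⟩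
  refine ⟨‖x₀‖⁻¹ • x₀, ⟨(sumZeroHyperplane n).smul_mem _ hx₀z, ?_⟩, ?_⟩
  · rw [norm_smul, norm_inv, norm_norm, inv_mul_cancel₀ hn.ne']
  rw [hface]
  ext y
  constructor
  · rintro ⟨hy, c, hc, rfl⟩
    exact ⟨sum_mem_braidFace hc hvx₀, hy⟩
  · rintro ⟨hyf, hy⟩
    refine ⟨hy, ?_⟩
    obtain ⟨ε, hε, hz⟩ : ∃ ε : ℝ, 0 < ε ∧ ∀ i j, x₀ i < x₀ j → x₀ i - ε * y i < x₀ j - ε * y j := by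
      have : ∀ᶠ ε in nhdsWithin (0 : ℝ) (Set.Ioi 0), ∀ i j, x₀ i < x₀ j →
          x₀ i - ε * y i < x₀ j - ε * y j := by
        apply nhdsWithin_le_nhds
        refine Filter.eventually_all.2 fun i => Filter.eventually_all.2 fun j => ?_
        by_cases h : x₀ i < x₀ j
        · have h1 : ContinuousAt (fun ε : ℝ => x₀ i - ε * y i) 0 := by fun_prop
          have h2 : ContinuousAt (fun ε : ℝ => x₀ j - ε * y j) 0 := by fun_prop
          filter_upwards [h1.eventually_lt h2 (by simpa using h)] with ε hε _ using hε
        · exact Filter.Eventually.of_forall fun ε h' => absurd h' h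
      obtain ⟨ε, h1, h2⟩ := (this.and self_mem_nhdsWithin).exists
      exact ⟨ε, h2, h1⟩
    have hzf : x₀ - ε • y ∈ braidFace x₀ := by
      intro i j
      simp only [PiLp.sub_apply, PiLp.smul_apply, smul_eq_mul]
      exact ⟨fun h => by rw [h, (hyf i j).1 h], fun h => (hz i j h).le⟩
    obtain ⟨d, hd, hde⟩ := exists_coeff hs' (braidFace_subset hx₀x hzf)
      (Submodule.sub_mem _ hx₀z (Submodule.smul_mem _ _ hy.1))
    obtain ⟨c, hc, hce⟩ := exists_coeff hs' (braidFace_subset hx₀x hyf) hy.1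
    have hzero : ∑ v ∈ s, ((if v ∈ t then (1 : ℝ) else 0) - ε * c v - d v) • id v = 0 := by
      simp only [sub_smul, mul_smul, id, Finset.sum_sub_distrib, ← Finset.smul_sum]
      rw [← hx₀s, ← hce, ← hde, sub_self]
    have hcoef := hli' _ hzero
    refine ⟨c, fun v hv => hc v (hts hv), ?_⟩
    rw [hce]
    refine (Finset.sum_subset hts fun v hv hvt => ?_).symm
    have h1 := hcoef v hv
    rw [if_neg hvt] at h1
    have h2 := hc v hv
    have h3 := hd v hv
    have h4 : 0 ≤ ε * c v := mul_nonneg hε.le h2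
    have h5 : ε * c v = 0 := by linarith
    rw [(mul_eq_zero.1 h5).resolve_left hε.ne', zero_smul]

/-- The cells of the braid subdivision of the sphere that are contained in the set `A`. -/
def restrictedBraidCells {n : ℕ} (A : Set (EuclideanSpace ℝ (Fin n))) :
    Set (Set (EuclideanSpace ℝ (Fin n))) :=
  {C | C ∈ braidCells n ∧ C ⊆ A}

/-- The restriction of the braid subdivision of the sphere to the set `A`, as a simplicial complex:
its faces are the vertex sets of the spherical simplices among the cells contained in `A`. (That
every such cell is a spherical simplex has to be stated separately.) -/
def restrictedBraidComplex {n : ℕ} (A : Set (EuclideanSpace ℝ (Fin n))) :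
    PreAbstractSimplicialComplex (EuclideanSpace ℝ (Fin n)) where
  faces := {s | ∃ C ∈ restrictedBraidCells A, IsSphericalSimplex s C}
  isRelLowerSet_faces := by
    classical
    rintro s ⟨C, ⟨hC, hCA⟩, hs, hS, hli, rfl⟩
    refine ⟨hs, fun t hts ht => ⟨_, ⟨?_, ?_⟩, ht, fun v hv => hS v (hts hv),
      hli.mono (Finset.coe_subset.2 hts), rfl⟩⟩
    · exact sphericalHull_mem_braidCells hS hli hC hts ht
    · refine Set.Subset.trans ?_ hCA
      rintro y ⟨hy, c, hc, rfl⟩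
      refine ⟨hy, fun v => if v ∈ t then c v else 0, fun v _ => ?_, ?_⟩
      · dsimp only
        split_ifs with h
        · exact hc v h
        · exact le_rfl
      · simp only [ite_smul, zero_smul]
        rw [← Finset.sum_filter, Finset.filter_mem_eq_inter, Finset.inter_eq_right.2 hts]

namespace OrderedSetPartition

/-! ### Two-block partitions and chains of subsets -/

/-- The first block of a two-block partition. -/
def firstBlock {n : ℕ} (v : TwoBlock n) : Finset (Fin n) := v.1.blocks.headI

theorem blocks_eq {n : ℕ} (v : TwoBlock n) : v.1.blocks = [firstBlock v, (firstBlock v)ᶜ] := by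
  obtain ⟨v, hv⟩ := v
  obtain ⟨a, b, hab⟩ := List.length_eq_two.1 hv
  have hd := v.disjoint
  have hc := v.cover
  simp only [hab, List.pairwise_cons, List.mem_cons, List.not_mem_nil, or_false, forall_eq,
    exists_eq_or_imp, exists_eq_left] at hd hc
  have : b = aᶜ := by
    ext i
    rw [Finset.mem_compl]
    exact ⟨fun hb ha => Finset.disjoint_left.1 hd.1 ha hb, fun ha => (hc i).resolve_left ha⟩
  simp [firstBlock, hab, this]

theorem firstBlock_nonempty {n : ℕ} (v : TwoBlock n) : (firstBlock v).Nonempty :=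
  v.1.nonempty_of_mem _ (by simp [blocks_eq])

theorem compl_firstBlock_nonempty {n : ℕ} (v : TwoBlock n) : ((firstBlock v)ᶜ).Nonempty :=
  v.1.nonempty_of_mem _ (by simp [blocks_eq])

theorem firstBlock_injective {n : ℕ} : Function.Injective (firstBlock (n := n)) := by
  intro v w h
  apply Subtype.ext
  apply OrderedSetPartition.ext
  rw [blocks_eq, blocks_eq, h]

theorem exists_firstBlock_eq {n : ℕ} {A : Finset (Fin n)} (h : A.Nonempty) (h' : Aᶜ.Nonempty) :
    ∃ v : TwoBlock n, firstBlock v = A :=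
  ⟨⟨⟨[A, Aᶜ], by simp [h, h'], by simp [disjoint_compl_right], fun i => by
    simp [em]⟩, rfl⟩, rfl⟩

noncomputable instance (n : ℕ) : Fintype (TwoBlock n) :=
  Fintype.ofInjective firstBlock firstBlock_injective

theorem le_iff_exists_split {n : ℕ} {v : TwoBlock n} {B : OrderedSetPartition n} :
    v.1 ≤ B ↔ ∃ p q, p ≠ [] ∧ q ≠ [] ∧ B.blocks = p ++ q ∧ firstBlock v = union p := by
  constructor
  · intro h
    obtain ⟨p, q, hp, hq, hB, hv⟩ := exists_split_of_le v.2 h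
    exact ⟨p, q, hp, hq, hB, by simp [firstBlock, hv]⟩
  · rintro ⟨p, q, hp, hq, hB, hv⟩
    refine le_of_split _ B p q rfl hp hq hB ?_
    have hd := B.disjoint
    rw [hB, List.pairwise_append] at hd
    have : union q = (union p)ᶜ := by
      ext i
      rw [Finset.mem_compl]
      constructor
      · intro hi hi'
        obtain ⟨b, hb, hib⟩ := mem_union.1 hi
        obtain ⟨c, hc, hic⟩ := mem_union.1 hi'
        exact Finset.disjoint_left.1 (hd.2.2 c hc b hb) hic hib
      · intro hi
        obtain ⟨b, hb, hib⟩ := B.cover i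
        rw [hB, List.mem_append] at hb
        exact mem_union.2 ⟨b, hb.resolve_left fun h => hi (mem_union.2 ⟨b, h, hib⟩), hib⟩
    rw [blocks_eq, hv, this]

/-- The first blocks of the two-block partitions below a given partition form a chain. -/
theorem firstBlock_subset_total {n : ℕ} {v w : TwoBlock n} {B : OrderedSetPartition n}
    (hv : v.1 ≤ B) (hw : w.1 ≤ B) :
    firstBlock v ⊆ firstBlock w ∨ firstBlock w ⊆ firstBlock v := by
  obtain ⟨p, q, -, -, hB, hvp⟩ := le_iff_exists_split.1 hv
  obtain ⟨p', q', -, -, hB', hwp⟩ := le_iff_exists_split.1 hw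
  rw [hvp, hwp]
  rw [hB] at hB'
  rcases List.append_eq_append_iff.1 hB' with ⟨a, rfl, -⟩ | ⟨a, rfl, -⟩
  · left; rw [union_append]; exact Finset.subset_union_left
  · right; rw [union_append]; exact Finset.subset_union_left

/-- A nonempty set is contained in a block of `B` if and only if it is not cut by any two-block
partition below `B`. -/
theorem exists_block_iff {n : ℕ} {B : OrderedSetPartition n} {e : Set (Fin n)}
    (he : e.Nonempty) :
    (∃ b ∈ B.blocks, e ⊆ (b : Set (Fin n))) ↔ ∀ v : TwoBlock n, v.1 ≤ B →
      (∀ i ∈ e, i ∈ firstBlock v) ∨ (∀ i ∈ e, i ∉ firstBlock v) := by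
  have hd := B.disjoint
  constructor
  · rintro ⟨b, hb, heb⟩ v hv
    obtain ⟨p, q, -, -, hB, hvp⟩ := le_iff_exists_split.1 hv
    rw [hvp]
    rw [hB, List.pairwise_append] at hd
    rw [hB, List.mem_append] at hb
    rcases hb with hb | hb
    · exact Or.inl fun i hi => mem_union.2 ⟨b, hb, heb hi⟩
    · refine Or.inr fun i hi hi' => ?_
      obtain ⟨c, hc, hic⟩ := mem_union.1 hi'
      exact Finset.disjoint_left.1 (hd.2.2 c hc b hb) hic (heb hi)
  · intro h
    obtain ⟨i, hi⟩ := he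
    obtain ⟨b, hb, hib⟩ := B.cover i
    obtain ⟨p, q, hB⟩ := List.append_of_mem hb
    refine ⟨b, hb, fun j hj => ?_⟩
    have key : ∀ p' q', B.blocks = p' ++ q' → (i ∈ union p' ↔ j ∈ union p') := by
      intro p' q' hB'
      by_cases hp : p' = []
      · simp [hp, union]
      by_cases hq : q' = []
      · have : ∀ k, k ∈ union p' := fun k => by
          obtain ⟨c, hc, hk⟩ := B.cover k
          exact mem_union.2 ⟨c, by simpa [hB', hq] using hc, hk⟩
        simp [this]
      have hne : ∀ l : List (Finset (Fin n)), l ≠ [] → (∀ b ∈ l, b ∈ B.blocks) →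
          (union l).Nonempty := by
        intro l hl hlB
        obtain ⟨c, l, rfl⟩ := List.exists_cons_of_ne_nil hl
        obtain ⟨k, hk⟩ := B.nonempty_of_mem c (hlB c (by simp))
        exact ⟨k, mem_union.2 ⟨c, by simp, hk⟩⟩
      obtain ⟨k, hk⟩ := hne q' hq (by simp +contextual [hB'])
      have hkp : k ∉ union p' := by
        intro hk'
        obtain ⟨c, hc, hkc⟩ := mem_union.1 hk
        obtain ⟨c', hc', hkc'⟩ := mem_union.1 hk'
        rw [hB', List.pairwise_append] at hd
        exact Finset.disjoint_left.1 (hd.2.2 c' hc' c hc) hkc' hkc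
      obtain ⟨v, hv⟩ := exists_firstBlock_eq (hne p' hp (by simp +contextual [hB']))
        ⟨k, Finset.mem_compl.2 hkp⟩
      have := h v (le_iff_exists_split.2 ⟨p', q', hp, hq, hB', hv⟩)
      rw [hv] at this
      rcases this with h | h
      · simp [h i hi, h j hj]
      · simp [h i hi, h j hj]
    have h1 := key p (b :: q) hB
    have h2 := key (p ++ [b]) q (by simp [hB])
    rw [hB, List.pairwise_append] at hd
    have hip : i ∉ union p := by
      intro hi'
      obtain ⟨c, hc, hic⟩ := mem_union.1 hi'
      exact Finset.disjoint_left.1 (hd.2.2 c hc b (by simp)) hic hib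
    have h3 : j ∈ union (p ++ [b]) :=
      h2.1 (mem_union.2 ⟨b, by simp, hib⟩)
    rw [union_append, Finset.mem_union] at h3
    simpa [union] using h3.resolve_left fun h => hip (h1.2 h)

/-! ### The ordered set partition of a real function -/

/-- The ordered set partition into the level sets of a function, by increasing value. -/
noncomputable def ofFun {n : ℕ} (x : Fin n → ℝ) : OrderedSetPartition n where
  blocks := ((Finset.univ.image x).sort (· ≤ ·)).map fun t => Finset.univ.filter fun i => x i = t
  nonempty_of_mem := by
    intro b hb
    simp only [List.mem_map, Finset.mem_sort, Finset.mem_image, Finset.mem_univ, true_and] at hb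
    obtain ⟨t, ⟨i, hi⟩, rfl⟩ := hb
    exact ⟨i, by simp [hi]⟩
  disjoint := by
    rw [List.pairwise_map]
    refine (Finset.sort_nodup _ _).imp fun {a b} hab => ?_
    rw [Finset.disjoint_left]
    intro i hi hi'
    simp only [Finset.mem_filter, Finset.mem_univ, true_and] at hi hi'
    exact hab (hi.symm.trans hi')
  cover := by
    intro i
    exact ⟨_, List.mem_map.2 ⟨x i, by simp, rfl⟩, by simp⟩

theorem le_ofFun_iff {n : ℕ} {v : TwoBlock n} {x : Fin n → ℝ} :
    v.1 ≤ ofFun x ↔ ∀ i ∈ firstBlock v, ∀ j ∉ firstBlock v, x i < x j := by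
  rw [le_iff_exists_split]
  have hU : ∀ (l : List ℝ) i,
      i ∈ union (l.map fun t => Finset.univ.filter fun i => x i = t) ↔ x i ∈ l := by
    intro l i
    simp [mem_union]
  constructor
  · rintro ⟨p, q, -, -, hB, hv⟩ i hi j hj
    obtain ⟨l₁, l₂, hl, rfl, rfl⟩ := List.map_eq_append_iff.1 hB
    rw [hv, hU] at hi hj
    have hj' : x j ∈ (Finset.univ.image x).sort (· ≤ ·) := by simp
    have hs := (Finset.sortedLT_sort (Finset.univ.image x)).pairwise
    rw [hl, List.mem_append] at hj'
    rw [hl, List.pairwise_append] at hs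
    exact hs.2.2 _ hi _ (hj'.resolve_left hj)
  · intro h
    set A := firstBlock v with hA
    have hl : (Finset.univ.image x).sort (· ≤ ·) =
        (A.image x).sort (· ≤ ·) ++ (Aᶜ.image x).sort (· ≤ ·) := by
      refine List.Perm.eq_of_pairwise (le := (· < ·)) (fun a b _ _ h h' => absurd h h'.asymm)
        (Finset.sortedLT_sort _).pairwise ?_ ?_
      · rw [List.pairwise_append]
        refine ⟨(Finset.sortedLT_sort _).pairwise, (Finset.sortedLT_sort _).pairwise, ?_⟩
        intro a ha b hb
        simp only [Finset.mem_sort, Finset.mem_image, Finset.mem_compl] at ha hb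
        obtain ⟨i, hi, rfl⟩ := ha
        obtain ⟨j, hj, rfl⟩ := hb
        exact h i hi j hj
      · refine (List.perm_ext_iff_of_nodup (Finset.sort_nodup _ _) ?_).2 fun t => ?_
        · refine (Finset.sort_nodup _ _).append (Finset.sort_nodup _ _) fun t ht ht' => ?_
          simp only [Finset.mem_sort, Finset.mem_image, Finset.mem_compl] at ht ht'
          obtain ⟨i, hi, rfl⟩ := ht
          obtain ⟨j, hj, hij⟩ := ht'
          exact (h i hi j hj).ne hij.symm
        · simp only [Finset.mem_sort, Finset.mem_image, List.mem_append, Finset.mem_compl,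
            Finset.mem_univ, true_and, ← exists_or, ← or_and_right, em]
    refine ⟨_, _, ?_, ?_, (congrArg (List.map _) hl).trans List.map_append, ?_⟩
    · obtain ⟨i, hi⟩ := firstBlock_nonempty v
      refine List.ne_nil_of_mem (List.mem_map.2 ⟨x i, ?_, rfl⟩)
      simpa using ⟨i, hi, rfl⟩
    · obtain ⟨i, hi⟩ := compl_firstBlock_nonempty v
      refine List.ne_nil_of_mem (List.mem_map.2 ⟨x i, ?_, rfl⟩)
      exact (Finset.mem_sort _).2 (Finset.mem_image_of_mem _ hi)
    · ext i
      rw [hU, Finset.mem_sort, Finset.mem_image]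
      refine ⟨fun hi => ⟨i, hi, rfl⟩, ?_⟩
      rintro ⟨k, hk, hki⟩
      by_contra hi
      exact (h k hk i hi).ne hki

end OrderedSetPartition

open OrderedSetPartition

/-! ### Initial sets of a vector -/

open Classical in
/-- The two-block partitions whose first block consists of the coordinates at which `x` is
smallest. -/
noncomputable def initials {n : ℕ} (x : EuclideanSpace ℝ (Fin n)) : Finset (TwoBlock n) :=
  Finset.univ.filter fun v => ∀ i ∈ firstBlock v, ∀ j ∉ firstBlock v, x i < x j

theorem mem_initials {n : ℕ} {x : EuclideanSpace ℝ (Fin n)} {v : TwoBlock n} :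
    v ∈ initials x ↔ ∀ i ∈ firstBlock v, ∀ j ∉ firstBlock v, x i < x j := by
  simp [initials]

/-- A set of two-block partitions whose first blocks are totally ordered by inclusion. -/
def IsBlockChain {n : ℕ} (s : Finset (TwoBlock n)) : Prop :=
  ∀ v ∈ s, ∀ w ∈ s, firstBlock v ⊆ firstBlock w ∨ firstBlock w ⊆ firstBlock v

theorem IsBlockChain.mono {n : ℕ} {s t : Finset (TwoBlock n)} (ht : IsBlockChain t) (h : s ⊆ t) :
    IsBlockChain s := fun v hv w hw => ht v (h hv) w (h hw)

theorem isBlockChain_initials {n : ℕ} (x : EuclideanSpace ℝ (Fin n)) :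
    IsBlockChain (initials x) := fun _ hv _ hw =>
  firstBlock_subset_total (le_ofFun_iff.2 (mem_initials.1 hv)) (le_ofFun_iff.2 (mem_initials.1 hw))

/-- An element of a chain can be distinguished from the others by a pair of coordinates. -/
theorem IsBlockChain.exists_separating {n : ℕ} {s : Finset (TwoBlock n)} (hs : IsBlockChain s)
    {v : TwoBlock n} (hv : v ∈ s) : ∃ i ∈ firstBlock v, ∃ j ∉ firstBlock v,
      ∀ w ∈ s, w ≠ v → (i ∈ firstBlock w ↔ j ∈ firstBlock w) := by
  classical
  have hi : ∃ i ∈ firstBlock v, ∀ w ∈ s, firstBlock w ⊂ firstBlock v → i ∉ firstBlock w := by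
    by_cases h : (s.filter fun w => firstBlock w ⊂ firstBlock v).Nonempty
    · obtain ⟨u, hu, hmax⟩ := Finset.exists_max_image _ (fun w => (firstBlock w).card) h
      rw [Finset.mem_filter] at hu
      obtain ⟨i, hiv, hiu⟩ := Finset.exists_of_ssubset hu.2
      refine ⟨i, hiv, fun w hw hwv hiw => ?_⟩
      rcases hs w hw u hu.1 with h' | h'
      · exact hiu (h' hiw)
      · have := Finset.eq_of_subset_of_card_le h' (hmax w (Finset.mem_filter.2 ⟨hw, hwv⟩))
        exact hiu (this ▸ hiw)
    · obtain ⟨i, hi⟩ := firstBlock_nonempty v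
      exact ⟨i, hi, fun w hw hwv => absurd ⟨w, Finset.mem_filter.2 ⟨hw, hwv⟩⟩ h⟩
  have hj : ∃ j ∉ firstBlock v, ∀ w ∈ s, firstBlock v ⊂ firstBlock w → j ∈ firstBlock w := by
    by_cases h : (s.filter fun w => firstBlock v ⊂ firstBlock w).Nonempty
    · obtain ⟨u, hu, hmin⟩ := Finset.exists_min_image _ (fun w => (firstBlock w).card) h
      rw [Finset.mem_filter] at hu
      obtain ⟨j, hju, hjv⟩ := Finset.exists_of_ssubset hu.2
      refine ⟨j, hjv, fun w hw hwv => ?_⟩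
      rcases hs w hw u hu.1 with h' | h'
      · have := Finset.eq_of_subset_of_card_le h' (hmin w (Finset.mem_filter.2 ⟨hw, hwv⟩))
        exact this ▸ hju
      · exact h' hju
    · obtain ⟨j, hj⟩ := compl_firstBlock_nonempty v
      exact ⟨j, Finset.mem_compl.1 hj,
        fun w hw hwv => absurd ⟨w, Finset.mem_filter.2 ⟨hw, hwv⟩⟩ h⟩
  obtain ⟨i, hi, hi'⟩ := hi
  obtain ⟨j, hj, hj'⟩ := hj
  refine ⟨i, hi, j, hj, fun w hw hne => ?_⟩
  have hne' : firstBlock w ≠ firstBlock v := fun h => hne (firstBlock_injective h)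
  rcases hs w hw v hv with h | h
  · have := hi' w hw (h.ssubset_of_ne hne')
    exact iff_of_false this fun h' => hj (h h')
  · exact iff_of_true (h hi) (hj' w hw (h.ssubset_of_ne hne'.symm))

/-! ### The rays of the braid arrangement -/

/-- The projection to the sum-zero hyperplane of the indicator vector of the complement of `A`. -/
noncomputable def cutVector {n : ℕ} (A : Finset (Fin n)) : EuclideanSpace ℝ (Fin n) :=
  WithLp.toLp 2 fun i => (A.card : ℝ) / n - if i ∈ A then 1 else 0

theorem cutVector_apply {n : ℕ} (A : Finset (Fin n)) (i : Fin n) :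
    cutVector A i = (A.card : ℝ) / n - if i ∈ A then 1 else 0 := rfl

theorem cutVector_mem {n : ℕ} (A : Finset (Fin n)) : cutVector A ∈ sumZeroHyperplane n := by
  change ∑ i, cutVector A i = 0
  rcases Nat.eq_zero_or_pos n with rfl | hn
  · simp
  · have : (n : ℝ) ≠ 0 := by positivity
    simp [cutVector_apply, mul_div_cancel₀ _ this]

theorem cutVector_ne_zero {n : ℕ} (v : TwoBlock n) : cutVector (firstBlock v) ≠ 0 := by
  intro h
  obtain ⟨i, hi⟩ := firstBlock_nonempty v
  obtain ⟨j, hj⟩ := compl_firstBlock_nonempty v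
  have h1 : cutVector (firstBlock v) i = 0 := by simp [h]
  have h2 : cutVector (firstBlock v) j = 0 := by simp [h]
  rw [cutVector_apply, if_pos hi] at h1
  rw [cutVector_apply, if_neg (Finset.mem_compl.1 hj)] at h2
  linarith

/-- The unit vector spanning the ray of the braid arrangement that belongs to a two-block
partition. -/
noncomputable def cutRay {n : ℕ} (v : TwoBlock n) : EuclideanSpace ℝ (Fin n) :=
  ‖cutVector (firstBlock v)‖⁻¹ • cutVector (firstBlock v)

/-- The difference between the two values that `cutRay v` takes. -/
noncomputable def cutGap {n : ℕ} (v : TwoBlock n) : ℝ := ‖cutVector (firstBlock v)‖⁻¹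

theorem cutGap_pos {n : ℕ} (v : TwoBlock n) : 0 < cutGap v :=
  inv_pos.2 (norm_pos_iff.2 (cutVector_ne_zero v))

theorem cutRay_mem_sumZeroSphere {n : ℕ} (v : TwoBlock n) : cutRay v ∈ sumZeroSphere n := by
  refine ⟨Submodule.smul_mem _ _ (cutVector_mem _), ?_⟩
  rw [cutRay, norm_smul, norm_inv, norm_norm,
    inv_mul_cancel₀ (norm_ne_zero_iff.2 (cutVector_ne_zero v))]

theorem cutRay_sub {n : ℕ} (v : TwoBlock n) (i j : Fin n) : cutRay v j - cutRay v i =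
    cutGap v * ((if i ∈ firstBlock v then 1 else 0) - if j ∈ firstBlock v then 1 else 0) := by
  simp only [cutRay, cutGap, PiLp.smul_apply, smul_eq_mul, cutVector_apply]
  ring

theorem sum_cutRay_sub {n : ℕ} (s : Finset (TwoBlock n)) (c : TwoBlock n → ℝ) (i j : Fin n) :
    (∑ v ∈ s, c v • cutRay v) j - (∑ v ∈ s, c v • cutRay v) i = ∑ v ∈ s, c v * (cutGap v *
      ((if i ∈ firstBlock v then 1 else 0) - if j ∈ firstBlock v then 1 else 0)) := by
  simp only [WithLp.ofLp_sum, Finset.sum_apply, PiLp.smul_apply, smul_eq_mul,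
    ← Finset.sum_sub_distrib, ← mul_sub, cutRay_sub]

/-- The coefficients of a linear combination of the rays of a chain are determined. -/
theorem IsBlockChain.coeff_eq {n : ℕ} {s : Finset (TwoBlock n)} (hs : IsBlockChain s)
    {c d : TwoBlock n → ℝ} (h : ∑ v ∈ s, c v • cutRay v = ∑ v ∈ s, d v • cutRay v) :
    ∀ v ∈ s, c v = d v := by
  intro v hv
  obtain ⟨i, hi, j, hj, hij⟩ := hs.exists_separating hv
  have key : ∀ c : TwoBlock n → ℝ,
      (∑ v ∈ s, c v • cutRay v) j - (∑ v ∈ s, c v • cutRay v) i = c v * cutGap v := by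
    intro c
    rw [sum_cutRay_sub, Finset.sum_eq_single_of_mem v hv]
    · simp [hi, hj]
    · intro w hw hne
      simp [hij w hw hne]
  have h1 := key c
  rw [h, key d] at h1
  exact (mul_right_cancel₀ (cutGap_pos v).ne' h1).symm

/-- The initial sets of a positive combination of the rays of a chain are the members of the
chain. -/
theorem IsBlockChain.initials_sum {n : ℕ} {s : Finset (TwoBlock n)} (hs : IsBlockChain s)
    {c : TwoBlock n → ℝ} (hc : ∀ v ∈ s, 0 < c v) :
    initials (∑ v ∈ s, c v • cutRay v) = s := by
  set x := ∑ v ∈ s, c v • cutRay v with hx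
  have hsub : ∀ v ∈ s, ∀ i ∈ firstBlock v, ∀ j ∉ firstBlock v, x i < x j := by
    intro v hv i hi j hj
    rw [← sub_pos, hx, sum_cutRay_sub]
    refine Finset.sum_pos' (fun w hw => ?_) ⟨v, hv, ?_⟩
    · refine mul_nonneg (hc w hw).le (mul_nonneg (cutGap_pos w).le ?_)
      rcases hs v hv w hw with h | h
      · rw [if_pos (h hi)]
        split_ifs <;> norm_num
      · rw [if_neg fun h' => hj (h h')]
        split_ifs <;> norm_num
    · rw [if_pos hi, if_neg hj]
      simpa using mul_pos (hc v hv) (cutGap_pos v)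
  ext v
  refine ⟨fun hv => ?_, fun hv => mem_initials.2 (hsub v hv)⟩
  rw [mem_initials] at hv
  obtain ⟨i, hi, himax⟩ := Finset.exists_max_image _ (fun i => x i) (firstBlock_nonempty v)
  obtain ⟨j, hj, hjmin⟩ := Finset.exists_min_image _ (fun i => x i) (compl_firstBlock_nonempty v)
  have hlt := hv i hi j (Finset.mem_compl.1 hj)
  rw [← sub_pos, hx, sum_cutRay_sub] at hlt
  obtain ⟨w, hw, hpos⟩ := Finset.exists_lt_of_sum_lt
    (f := fun _ => (0 : ℝ)) (by simpa using hlt)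
  have hpos' := pos_of_mul_pos_right (pos_of_mul_pos_right hpos (hc w hw).le) (cutGap_pos w).le
  have hiw : i ∈ firstBlock w := by
    by_contra h
    rw [if_neg h] at hpos'
    split_ifs at hpos' <;> norm_num at hpos'
  have hjw : j ∉ firstBlock w := by
    intro h
    rw [if_pos hiw, if_pos h] at hpos'
    norm_num at hpos'
  have : firstBlock v = firstBlock w := by
    ext k
    constructor
    · intro hk
      by_contra hk'
      exact (himax k hk).not_gt (hsub w hw i hiw k hk')
    · intro hk
      by_contra hk'
      exact (hjmin k (Finset.mem_compl.2 hk')).not_gt (hsub w hw k hk j hjw)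
  rw [firstBlock_injective this]
  exact hw

theorem initials_smul {n : ℕ} {a : ℝ} (ha : 0 < a) (x : EuclideanSpace ℝ (Fin n)) :
    initials (a • x) = initials x := by
  ext v
  simp [mem_initials, mul_lt_mul_iff_right₀ ha]

/-- Every vector of the sum-zero hyperplane is a positive combination of the rays of its initial
sets. -/
theorem exists_eq_sum_cutRay {n : ℕ} {x : EuclideanSpace ℝ (Fin n)}
    (hx : x ∈ sumZeroHyperplane n) : ∃ c : TwoBlock n → ℝ, (∀ v ∈ initials x, 0 < c v) ∧
      x = ∑ v ∈ initials x, c v • cutRay v := by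
  classical
  obtain ⟨k, hk⟩ : ∃ k, (initials x).card = k := ⟨_, rfl⟩
  induction k generalizing x with
  | zero =>
    rw [Finset.card_eq_zero] at hk
    refine ⟨fun _ => 0, by simp [hk], ?_⟩
    rw [hk, Finset.sum_empty]
    have hle : ∀ i j, x j ≤ x i := by
      intro i j
      by_contra! h
      obtain ⟨v, hv⟩ := exists_firstBlock_eq (A := Finset.univ.filter fun k => x k ≤ x i)
        ⟨i, by simp⟩ ⟨j, by simpa using h⟩
      have : v ∈ initials x := by
        rw [mem_initials, hv]
        intro a ha b hb
        simp only [Finset.mem_filter, Finset.mem_univ, true_and, not_le] at ha hb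
        exact ha.trans_lt hb
      simp [hk] at this
    ext i
    have h0 : ∑ j, x j = 0 := hx
    have h1 : ∑ j, x j = n * x i := by
      rw [Finset.sum_congr rfl fun j _ => le_antisymm (hle i j) (hle j i)]
      simp
    have hn : (n : ℝ) ≠ 0 := by
      have := i.pos
      positivity
    rw [h0] at h1
    simpa [hn] using h1.symm
  | succ k ih =>
    obtain ⟨v, hv⟩ : (initials x).Nonempty := Finset.card_pos.1 (by omega)
    have hv' := mem_initials.1 hv
    obtain ⟨i₀, hi₀, hmax⟩ := Finset.exists_max_image _ (fun i => x i) (firstBlock_nonempty v)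
    obtain ⟨j₀, hj₀, hmin⟩ :=
      Finset.exists_min_image _ (fun i => x i) (compl_firstBlock_nonempty v)
    rw [Finset.mem_compl] at hj₀
    have hd : 0 < x j₀ - x i₀ := sub_pos.2 (hv' i₀ hi₀ j₀ hj₀)
    set a := (x j₀ - x i₀) / cutGap v with ha
    have ha0 : 0 < a := div_pos hd (cutGap_pos v)
    set y := x - a • cutRay v with hy
    have hyd : ∀ i j, y j - y i = x j - x i - (x j₀ - x i₀) *
        ((if i ∈ firstBlock v then 1 else 0) - if j ∈ firstBlock v then 1 else 0) := by
      intro i j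
      have h1 : a * cutGap v = x j₀ - x i₀ := div_mul_cancel₀ _ (cutGap_pos v).ne'
      have h2 := cutRay_sub v i j
      simp only [hy, PiLp.sub_apply, PiLp.smul_apply, smul_eq_mul]
      rw [← h1, mul_assoc, ← h2]
      ring
    have hgap : ∀ i ∈ firstBlock v, ∀ j ∉ firstBlock v, x j₀ - x i₀ ≤ x j - x i :=
      fun i hi j hj => sub_le_sub (hmin j (Finset.mem_compl.2 hj)) (hmax i hi)
    have hmono : ∀ i j, x i ≤ x j → y i ≤ y j := by
      intro i j hij
      rw [← sub_nonneg, hyd]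
      by_cases hi : i ∈ firstBlock v <;> by_cases hj : j ∈ firstBlock v
      · simpa [hi, hj] using hij
      · simpa [hi, hj] using hgap i hi j hj
      · exact absurd (hv' j hj i hi) hij.not_gt
      · simpa [hi, hj] using hij
    have hinit : initials y = (initials x).erase v := by
      ext w
      rw [Finset.mem_erase, mem_initials, mem_initials]
      constructor
      · intro h
        refine ⟨?_, fun i hi j hj => lt_of_not_ge fun h' => (h i hi j hj).not_ge (hmono j i h')⟩
        rintro rfl
        have := sub_pos.2 (h i₀ hi₀ j₀ hj₀)
        rw [hyd, if_pos hi₀, if_neg hj₀] at this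
        linarith
      · rintro ⟨hne, h⟩ i hi j hj
        have hne' : firstBlock w ≠ firstBlock v := fun h => hne (firstBlock_injective h)
        rw [← sub_pos, hyd]
        have hij := h i hi j hj
        by_cases hiv : i ∈ firstBlock v <;> by_cases hjv : j ∈ firstBlock v
        · simpa [hiv, hjv] using hij
        · suffices x j₀ - x i₀ < x j - x i by simpa [hiv, hjv] using this
          rcases isBlockChain_initials x w (mem_initials.2 h) v hv with hwv | hwv
          · obtain ⟨k, hkv, hkw⟩ := Finset.exists_of_ssubset (hwv.ssubset_of_ne hne')
            linarith [h i hi k hkw, hgap k hkv j hjv]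
          · obtain ⟨k, hkw, hkv⟩ := Finset.exists_of_ssubset (hwv.ssubset_of_ne hne'.symm)
            linarith [h k hkw j hj, hgap i hiv k hkv]
        · exact absurd (hv' j hjv i hiv) hij.asymm
        · simpa [hiv, hjv] using hij
    have hy0 : y ∈ sumZeroHyperplane n :=
      Submodule.sub_mem _ hx (Submodule.smul_mem _ _ (cutRay_mem_sumZeroSphere v).1)
    obtain ⟨c, hc, hcy⟩ := ih hy0 (by rw [hinit, Finset.card_erase_of_mem hv, hk]; rfl)
    refine ⟨fun w => if w = v then a else c w, fun w hw => ?_, ?_⟩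
    · dsimp only
      split_ifs with h
      · exact ha0
      · exact hc w (by rw [hinit]; exact Finset.mem_erase.2 ⟨h, hw⟩)
    · rw [← Finset.add_sum_erase _ _ hv]
      dsimp only
      rw [if_pos rfl, ← hinit, ← sub_eq_iff_eq_add', ← hy]
      refine hcy.trans (Finset.sum_congr rfl fun w hw => ?_)
      rw [hinit] at hw
      rw [if_neg (Finset.ne_of_mem_erase hw)]

theorem initials_cutRay {n : ℕ} (v : TwoBlock n) : initials (cutRay v) = {v} := by
  have := IsBlockChain.initials_sum (s := {v}) (c := fun _ => 1)
    (by simp [IsBlockChain]) (by simp)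
  simpa using this

theorem cutRay_injective {n : ℕ} : Function.Injective (cutRay (n := n)) := by
  intro v w h
  have := initials_cutRay v
  rw [h, initials_cutRay] at this
  exact (Finset.singleton_injective this).symm

/-- The initial sets of a nonnegative combination of the rays of a chain belong to the chain. -/
theorem IsBlockChain.initials_sum_subset {n : ℕ} {s : Finset (TwoBlock n)} (hs : IsBlockChain s)
    {c : TwoBlock n → ℝ} (hc : ∀ v ∈ s, 0 ≤ c v) :
    initials (∑ v ∈ s, c v • cutRay v) ⊆ s := by
  classical
  have h := (hs.mono (s.filter_subset fun v => c v ≠ 0)).initials_sum (c := c) (fun v hv => by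
    rw [Finset.mem_filter] at hv
    exact (hc v hv.1).lt_of_ne' hv.2)
  have hsum : ∑ v ∈ s.filter (fun v => c v ≠ 0), c v • cutRay v = ∑ v ∈ s, c v • cutRay v :=
    Finset.sum_filter_of_ne fun v _ h h' => h (by rw [h', zero_smul])
  rw [← hsum, h]
  exact Finset.filter_subset _ _

theorem initials_nonempty {n : ℕ} {x : EuclideanSpace ℝ (Fin n)} (hx : x ∈ sumZeroSphere n) :
    (initials x).Nonempty := by
  obtain ⟨c, -, hc⟩ := exists_eq_sum_cutRay hx.1
  by_contra h
  rw [Finset.not_nonempty_iff_eq_empty] at h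
  rw [h, Finset.sum_empty] at hc
  have := hx.2
  simp [hc] at this

/-! ### The faces of the complexes -/

theorem IsBlockChain.exists_partition {n : ℕ} {s : Finset (TwoBlock n)} (hs : IsBlockChain s) :
    ∃ B : OrderedSetPartition n, ∀ v : TwoBlock n, v ∈ s ↔ v.1 ≤ B := by
  refine ⟨ofFun (∑ v ∈ s, (1 : ℝ) • cutRay v : EuclideanSpace ℝ (Fin n)), fun v => ?_⟩
  rw [le_ofFun_iff, ← mem_initials, hs.initials_sum fun _ _ => one_pos]

theorem mem_orderedPartitionComplex {n : ℕ} {s : Finset (TwoBlock n)} :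
    s ∈ (orderedPartitionComplex n).faces ↔ s.Nonempty ∧ IsBlockChain s := by
  refine and_congr_right fun _ => ⟨?_, fun h => ?_⟩
  · rintro ⟨B, -, hB⟩ v hv w hw
    exact firstBlock_subset_total ((hB v).1 hv) ((hB w).1 hw)
  · obtain ⟨B, hB⟩ := h.exists_partition
    exact ⟨B, trivial, hB⟩

theorem mem_coloringComplex {n : ℕ} {H : Hypergraph (Fin n)}
    (hH : ∀ e ∈ H.edgeSet, e.Nonempty) {s : Finset (TwoBlock n)} :
    s ∈ (coloringComplex H).faces ↔ s.Nonempty ∧ IsBlockChain s ∧ ∃ e ∈ H.edgeSet, ∀ v ∈ s,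
      (∀ i ∈ e, i ∈ firstBlock v) ∨ (∀ i ∈ e, i ∉ firstBlock v) := by
  refine and_congr_right fun _ => ⟨?_, ?_⟩
  · rintro ⟨B, ⟨b, hb, e, he, heb⟩, hB⟩
    exact ⟨fun v hv w hw => firstBlock_subset_total ((hB v).1 hv) ((hB w).1 hw), e, he,
      fun v hv => (exists_block_iff (hH e he)).1 ⟨b, hb, heb⟩ v ((hB v).1 hv)⟩
  · rintro ⟨h, e, he, hes⟩
    obtain ⟨B, hB⟩ := h.exists_partition
    obtain ⟨b, hb, heb⟩ := (exists_block_iff (hH e he)).2 fun v hv => hes v ((hB v).2 hv)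
    exact ⟨B, ⟨b, hb, e, he, heb⟩, hB⟩

theorem coloringComplex_le_orderedPartitionComplex {n : ℕ} (H : Hypergraph (Fin n)) :
    coloringComplex H ≤ orderedPartitionComplex n := by
  rintro s ⟨hs, B, -, hB⟩
  exact ⟨hs, B, trivial, hB⟩

theorem coloringComplex_le_completeGraph {n : ℕ} (H : Hypergraph (Fin n))
    (hloop : ∀ e ∈ H.edgeSet, 2 ≤ e.ncard) :
    coloringComplex H ≤ coloringComplex (completeGraphHypergraph n) := by
  rintro s ⟨hs, B, ⟨b, hb, e, he, heb⟩, hB⟩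
  obtain ⟨f, hfe, hf⟩ := Set.exists_subset_card_eq (hloop e he)
  exact ⟨hs, B, ⟨b, hb, f, hf, hfe.trans heb⟩, hB⟩

/-- An injective map of vertices under which faces correspond to faces, and which reaches every
vertex, gives an isomorphism of simplicial complexes. -/
theorem SimpliciallyIsomorphic.of_embedding {α β : Type*} {K : PreAbstractSimplicialComplex α}
    {L : PreAbstractSimplicialComplex β} (g : α ↪ β)
    (h : ∀ s : Finset α, s ∈ K.faces ↔ s.map g ∈ L.faces)
    (hsurj : ∀ b, {b} ∈ L.faces → ∃ a, g a = b) : SimpliciallyIsomorphic K L := by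
  have hv : ∀ a, {a} ∈ K.faces ↔ {g a} ∈ L.faces := fun a => by
    rw [h, Finset.map_singleton]
  refine ⟨Equiv.ofBijective (fun a : K.Vertex => (⟨g a.1, (hv a.1).1 a.2⟩ : L.Vertex))
    ⟨fun a b hab => Subtype.ext (g.injective (Subtype.ext_iff.1 hab)), ?_⟩, fun s => ?_⟩
  · rintro ⟨b, hb⟩
    obtain ⟨a, rfl⟩ := hsurj b hb
    exact ⟨⟨a, (hv a).2 hb⟩, rfl⟩
  · rw [h, Finset.map_map, Finset.map_map]
    rfl

theorem orderedPartitionComplex_iso_sdBoundarySimplex (n : ℕ) :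
    SimpliciallyIsomorphic (orderedPartitionComplex n) (sdBoundarySimplex n) := by
  refine SimpliciallyIsomorphic.of_embedding ⟨firstBlock, firstBlock_injective⟩
    (fun s => ?_) fun A hA => ?_
  · rw [mem_orderedPartitionComplex]
    constructor
    · rintro ⟨hs, hc⟩
      refine ⟨hs.map, ?_, ?_⟩
      · simp only [Finset.mem_map, Function.Embedding.coeFn_mk]
        rintro _ ⟨v, -, rfl⟩
        refine ⟨firstBlock_nonempty v, fun h => ?_⟩
        simpa [h] using compl_firstBlock_nonempty v
      · simp only [Finset.coe_map, Function.Embedding.coeFn_mk]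
        rintro _ ⟨v, hv, rfl⟩ _ ⟨w, hw, rfl⟩ -
        exact hc v hv w hw
    · rintro ⟨hs, -, hc⟩
      exact ⟨Finset.map_nonempty.1 hs, fun v hv w hw =>
        hc.total (Finset.mem_coe.2 (Finset.mem_map_of_mem _ hv))
          (Finset.mem_coe.2 (Finset.mem_map_of_mem _ hw))⟩
  · obtain ⟨h1, h2⟩ := hA.2.1 A (by simp)
    exact exists_firstBlock_eq h1 (by
      rwa [Finset.nonempty_iff_ne_empty, Ne, Finset.compl_eq_empty_iff])

/-! ### The arrangement of a hypergraph -/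

theorem squarefreeMonomial_eq {n : ℕ} (A : Finset (Fin n)) :
    squarefreeMonomial A = MvPolynomial.monomial (Finsupp.indicator A fun _ _ => 1) 1 := by
  classical
  rw [MvPolynomial.monomial_eq, Finsupp.prod_fintype _ _ (by simp), squarefreeMonomial]
  simp [Finsupp.indicator_apply, Finset.prod_ite_mem]

theorem squarefreeMonomial_mem_edgeIdeal {n : ℕ} {H : Hypergraph (Fin n)} {A : Finset (Fin n)} :
    squarefreeMonomial A ∈ edgeIdeal H ↔
      ∃ F : Finset (Fin n), (F : Set (Fin n)) ∈ H.edgeSet ∧ F ⊆ A := by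
  classical
  have hspan : edgeIdeal H = Ideal.span ((fun s => MvPolynomial.monomial s (1 : ℝ)) ''
      ((fun F : Finset (Fin n) => Finsupp.indicator F fun _ _ => 1) ''
        {F | (F : Set (Fin n)) ∈ H.edgeSet})) := by
    rw [edgeIdeal]
    congr 1
    ext m
    simp [squarefreeMonomial_eq, eq_comm]
  rw [hspan, MvPolynomial.mem_ideal_span_monomial_image, squarefreeMonomial_eq]
  rw [MvPolynomial.support_monomial, if_neg one_ne_zero]
  simp only [Finset.mem_singleton, forall_eq, Set.exists_mem_image, Set.mem_ofPred_eq]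
  refine exists_congr fun F => and_congr_right fun _ => ⟨fun h i hi => ?_, fun h i => ?_⟩
  · by_contra hiA
    have := h i
    rw [Finsupp.indicator_of_mem hi, Finsupp.indicator_of_notMem hiA] at this
    omega
  · by_cases hi : i ∈ F
    · rw [Finsupp.indicator_of_mem hi, Finsupp.indicator_of_mem (h hi)]
    · rw [Finsupp.indicator_of_notMem hi]
      exact Nat.zero_le _

theorem mem_hypergraphArrangement {n : ℕ} {H : Hypergraph (Fin n)}
    {x : EuclideanSpace ℝ (Fin n)} : x ∈ hypergraphArrangement H ↔
      x ∈ sumZeroHyperplane n ∧ ∃ e ∈ H.edgeSet, ∀ i ∈ e, ∀ j ∈ e, x i = x j := by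
  classical
  simp only [hypergraphArrangement, canonicalArrangement, Set.mem_iUnion, exists_prop]
  constructor
  · rintro ⟨_, ⟨A, hA, rfl⟩, hxA, hx⟩
    obtain ⟨F, hF, hFA⟩ := squarefreeMonomial_mem_edgeIdeal.1 hA.1
    exact ⟨hx, F, hF, fun i hi j hj => hxA i (hFA hi) j (hFA hj)⟩
  · rintro ⟨hx, e, he, hxe⟩
    have hF : squarefreeMonomial e.toFinset ∈ edgeIdeal H :=
      squarefreeMonomial_mem_edgeIdeal.2 ⟨e.toFinset, by simpa using he, subset_rfl⟩
    obtain ⟨A, hAe, hA⟩ := exists_minimal_le_of_wellFoundedLT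
      (fun A : Finset (Fin n) => squarefreeMonomial A ∈ edgeIdeal H) _ hF
    refine ⟨_, ⟨A, ⟨hA.1, fun B hB hB' => hB.2 (hA.2 hB' hB.1)⟩, rfl⟩, fun i hi j hj => ?_, hx⟩
    exact hxe i (Set.mem_toFinset.1 (hAe hi)) j (Set.mem_toFinset.1 (hAe hj))

/-- A vector is constant on a set of coordinates if and only if no initial set cuts it. -/
theorem forall_eq_iff_initials {n : ℕ} {x : EuclideanSpace ℝ (Fin n)} {e : Set (Fin n)} :
    (∀ i ∈ e, ∀ j ∈ e, x i = x j) ↔ ∀ v ∈ initials x,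
      (∀ i ∈ e, i ∈ firstBlock v) ∨ (∀ i ∈ e, i ∉ firstBlock v) := by
  constructor
  · intro h v hv
    by_contra! hcut
    obtain ⟨⟨j, hj, hjv⟩, i, hi, hiv⟩ := hcut
    exact (mem_initials.1 hv i hiv j hjv).ne (h i hi j hj)
  · intro h
    have hle : ∀ i ∈ e, ∀ j ∈ e, x j ≤ x i := by
      intro i hi j hj
      by_contra! hij
      obtain ⟨v, hv⟩ := exists_firstBlock_eq (A := Finset.univ.filter fun k => x k ≤ x i)
        ⟨i, by simp⟩ ⟨j, by simpa using hij⟩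
      have hmem : v ∈ initials x := by
        rw [mem_initials, hv]
        intro a ha b hb
        simp only [Finset.mem_filter, Finset.mem_univ, true_and, not_le] at ha hb
        exact ha.trans_lt hb
      rcases h v hmem with h | h
      · have := h j hj
        rw [hv, Finset.mem_filter] at this
        exact this.2.not_gt hij
      · exact h i hi (by simp [hv])
    exact fun i hi j hj => le_antisymm (hle j hj i hi) (hle i hi j hj)

theorem initials_mem_coloringComplex {n : ℕ} {H : Hypergraph (Fin n)}
    (hH : ∀ e ∈ H.edgeSet, e.Nonempty) {x : EuclideanSpace ℝ (Fin n)}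
    (hx : x ∈ sumZeroSphere n) :
    initials x ∈ (coloringComplex H).faces ↔ x ∈ hypergraphArrangement H := by
  rw [mem_coloringComplex hH, mem_hypergraphArrangement]
  simp only [initials_nonempty hx, isBlockChain_initials, hx.1, forall_eq_iff_initials, true_and]

/-! ### The cells of the braid subdivision -/

theorem self_mem_braidFace {n : ℕ} (x : EuclideanSpace ℝ (Fin n)) : x ∈ braidFace x :=
  fun _ _ => ⟨id, le_of_lt⟩

theorem initials_subset_of_mem_braidFace {n : ℕ} {x y : EuclideanSpace ℝ (Fin n)}
    (h : y ∈ braidFace x) : initials y ⊆ initials x := by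
  intro v hv
  rw [mem_initials] at hv ⊢
  intro i hi j hj
  by_contra! hle
  rcases hle.lt_or_eq with h' | h'
  · exact (hv i hi j hj).not_ge ((h j i).2 h')
  · exact (hv i hi j hj).ne ((h j i).1 h').symm

theorem cutRay_mem_braidFace {n : ℕ} {x : EuclideanSpace ℝ (Fin n)} {v : TwoBlock n}
    (hv : v ∈ initials x) : cutRay v ∈ braidFace x := by
  have hv' := mem_initials.1 hv
  intro i j
  have h := cutRay_sub v i j
  have hg := cutGap_pos v
  constructor
  · intro hij
    have : i ∈ firstBlock v ↔ j ∈ firstBlock v :=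
      ⟨fun hi => by_contra fun hj => (hv' i hi j hj).ne hij,
        fun hj => by_contra fun hi => (hv' j hj i hi).ne hij.symm⟩
    simp only [this, sub_self, mul_zero] at h
    linarith
  · intro hij
    rw [← sub_nonneg, h]
    refine mul_nonneg hg.le ?_
    by_cases hj : j ∈ firstBlock v
    · have hi : i ∈ firstBlock v := by_contra fun hi => (hv' j hj i hi).asymm hij
      simp [hi, hj]
    · rw [if_neg hj]
      split_ifs <;> norm_num

/-- The rays as an embedding. -/
noncomputable def cutRayEmbedding (n : ℕ) : TwoBlock n ↪ EuclideanSpace ℝ (Fin n) :=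
  ⟨cutRay, cutRay_injective⟩

theorem mem_sphericalHull_map {n : ℕ} {s : Finset (TwoBlock n)} {y : EuclideanSpace ℝ (Fin n)} :
    y ∈ sphericalHull (s.map (cutRayEmbedding n)) ↔ y ∈ sumZeroSphere n ∧
      ∃ c : TwoBlock n → ℝ, (∀ v ∈ s, 0 ≤ c v) ∧ y = ∑ v ∈ s, c v • cutRay v := by
  refine and_congr_right fun _ => ⟨?_, ?_⟩
  · rintro ⟨c, hc, rfl⟩
    refine ⟨fun v => c (cutRay v), fun v hv => hc _ (Finset.mem_map_of_mem _ hv), ?_⟩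
    rw [Finset.sum_map]
    rfl
  · rintro ⟨c, hc, rfl⟩
    have hc' : ∀ v, Function.extend cutRay c 0 (cutRay v) = c v :=
      cutRay_injective.extend_apply c 0
    refine ⟨Function.extend cutRay c 0, ?_, ?_⟩
    · simp only [Finset.mem_map]
      rintro _ ⟨v, hv, rfl⟩
      exact (hc' v).symm ▸ hc v hv
    · rw [Finset.sum_map]
      exact Finset.sum_congr rfl fun v _ => by
        rw [cutRayEmbedding, Function.Embedding.coeFn_mk, hc' v]

theorem braidFace_inter_sumZeroSphere {n : ℕ} (x : EuclideanSpace ℝ (Fin n)) :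
    braidFace x ∩ sumZeroSphere n = sphericalHull ((initials x).map (cutRayEmbedding n)) := by
  classical
  ext y
  rw [mem_sphericalHull_map]
  constructor
  · rintro ⟨hy, hyS⟩
    refine ⟨hyS, ?_⟩
    obtain ⟨c, hc, hcy⟩ := exists_eq_sum_cutRay hyS.1
    refine ⟨fun v => if v ∈ initials y then c v else 0, fun v _ => ?_, ?_⟩
    · dsimp only
      split_ifs with h
      · exact (hc v h).le
      · exact le_rfl
    · simp only [ite_smul, zero_smul]
      rw [← Finset.sum_filter, Finset.filter_mem_eq_inter,
        Finset.inter_eq_right.2 (initials_subset_of_mem_braidFace hy)]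
      exact hcy
  · rintro ⟨hy, h⟩
    refine ⟨?_, hy⟩
    obtain ⟨-, c, hc, rfl⟩ := mem_sphericalHull_map.2 ⟨hy, h⟩
    refine sum_mem_braidFace hc fun u hu => ?_
    obtain ⟨v, hv, rfl⟩ := Finset.mem_map.1 hu
    exact cutRay_mem_braidFace hv

theorem IsBlockChain.linearIndepOn {n : ℕ} {s : Finset (TwoBlock n)} (hs : IsBlockChain s) :
    LinearIndepOn ℝ id (s.map (cutRayEmbedding n) : Set (EuclideanSpace ℝ (Fin n))) := by
  rw [linearIndepOn_finset_iff]
  intro c hc u hu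
  obtain ⟨v, hv, rfl⟩ := Finset.mem_map.1 hu
  rw [Finset.sum_map] at hc
  exact hs.coeff_eq (c := fun v => c (cutRay v)) (d := fun _ => 0)
    (hc.trans (by simp)) v hv

theorem isSphericalSimplex_initials {n : ℕ} {x : EuclideanSpace ℝ (Fin n)}
    (hx : x ∈ sumZeroSphere n) : IsSphericalSimplex ((initials x).map (cutRayEmbedding n))
      (braidFace x ∩ sumZeroSphere n) := by
  refine ⟨(initials_nonempty hx).map, fun u hu => ?_, (isBlockChain_initials x).linearIndepOn,
    braidFace_inter_sumZeroSphere x⟩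
  obtain ⟨v, -, rfl⟩ := Finset.mem_map.1 hu
  exact cutRay_mem_sumZeroSphere v

theorem mem_sphericalHull_self {n : ℕ} {s : Finset (EuclideanSpace ℝ (Fin n))}
    {v : EuclideanSpace ℝ (Fin n)} (hv : v ∈ s) (hS : v ∈ sumZeroSphere n) :
    v ∈ sphericalHull s := by
  classical
  exact ⟨hS, fun w => if w = v then 1 else 0,
    fun w _ => by dsimp only; split_ifs <;> norm_num, by simp [hv]⟩

/-- The vertex set of a simplicial cell is determined by the cell. -/
theorem eq_initials_of_sphericalHull_eq {n : ℕ} {s : Finset (TwoBlock n)}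
    {x : EuclideanSpace ℝ (Fin n)} (hx : x ∈ sumZeroSphere n)
    (h : braidFace x ∩ sumZeroSphere n = sphericalHull (s.map (cutRayEmbedding n))) :
    s = initials x := by
  have hsub : s ⊆ initials x := by
    intro v hv
    have hmem := mem_sphericalHull_self (Finset.mem_map_of_mem (cutRayEmbedding n) hv)
      (cutRay_mem_sumZeroSphere v)
    rw [← h] at hmem
    apply initials_subset_of_mem_braidFace hmem.1
    change v ∈ initials (cutRay v)
    rw [initials_cutRay]
    exact Finset.mem_singleton_self v
  have hxs : x ∈ sphericalHull (s.map (cutRayEmbedding n)) :=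
    h ▸ ⟨self_mem_braidFace x, hx⟩
  obtain ⟨-, c, hc, hxc⟩ := mem_sphericalHull_map.1 hxs
  refine hsub.antisymm ?_
  have := ((isBlockChain_initials x).mono hsub).initials_sum_subset hc
  rwa [← hxc] at this

theorem braidFace_inter_subset_hypergraphArrangement {n : ℕ} {H : Hypergraph (Fin n)}
    {x : EuclideanSpace ℝ (Fin n)} (hx : x ∈ sumZeroSphere n) :
    braidFace x ∩ sumZeroSphere n ⊆ hypergraphArrangement H ↔ x ∈ hypergraphArrangement H := by
  refine ⟨fun h => h ⟨self_mem_braidFace x, hx⟩, fun h y hy => ?_⟩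
  obtain ⟨-, e, he, hxe⟩ := mem_hypergraphArrangement.1 h
  exact mem_hypergraphArrangement.2 ⟨hy.2.1, e, he,
    fun i hi j hj => (hy.1 i j).1 (hxe i hi j hj)⟩

/-- A combination of the rays of a chain with positive coefficients, scaled to unit length. -/
theorem IsBlockChain.normalize_mem {n : ℕ} {s : Finset (TwoBlock n)} (hs : IsBlockChain s)
    (hne : s.Nonempty) {c : TwoBlock n → ℝ} (hc : ∀ v ∈ s, 0 < c v) :
    0 < ‖∑ v ∈ s, c v • cutRay v‖ ∧
      ‖∑ v ∈ s, c v • cutRay v‖⁻¹ • ∑ v ∈ s, c v • cutRay v ∈ sumZeroSphere n ∧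
      initials (‖∑ v ∈ s, c v • cutRay v‖⁻¹ • ∑ v ∈ s, c v • cutRay v) = s := by
  have h0 : ∑ v ∈ s, c v • cutRay v ≠ 0 := by
    intro h
    obtain ⟨v, hv⟩ := hne
    exact (hc v hv).ne' (hs.coeff_eq (d := fun _ => 0) (by simpa using h) v hv)
  have hn := norm_pos_iff.2 h0
  refine ⟨hn, ⟨Submodule.smul_mem _ _ (Submodule.sum_mem _ fun v _ =>
    Submodule.smul_mem _ _ (cutRay_mem_sumZeroSphere v).1), ?_⟩, ?_⟩
  · rw [norm_smul, norm_inv, norm_norm, inv_mul_cancel₀ hn.ne']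
  · rw [initials_smul (inv_pos.2 hn), hs.initials_sum hc]

theorem coloringComplex_iso_restrictedBraidComplex {n : ℕ} {H : Hypergraph (Fin n)}
    (hH : ∀ e ∈ H.edgeSet, e.Nonempty) :
    SimpliciallyIsomorphic (coloringComplex H)
      (restrictedBraidComplex (hypergraphArrangement H)) := by
  refine SimpliciallyIsomorphic.of_embedding (cutRayEmbedding n) (fun s => ⟨fun hs => ?_, ?_⟩) ?_
  · obtain ⟨hne, hc, -⟩ := (mem_coloringComplex hH).1 hs
    obtain ⟨-, hx, hinit⟩ := hc.normalize_mem hne (c := fun _ => 1) fun _ _ => one_pos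
    refine ⟨_, ⟨⟨_, hx, rfl⟩, ?_⟩, ?_⟩
    · rw [braidFace_inter_subset_hypergraphArrangement hx, ← initials_mem_coloringComplex hH hx,
        hinit]
      exact hs
    · have := isSphericalSimplex_initials hx
      rwa [hinit] at this
  · rintro ⟨_, ⟨⟨x, hx, rfl⟩, hxA⟩, -, -, -, hull⟩
    rw [eq_initials_of_sphericalHull_eq hx hull, initials_mem_coloringComplex hH hx]
    exact (braidFace_inter_subset_hypergraphArrangement hx).1 hxA
  · rintro u ⟨_, ⟨⟨x, hx, rfl⟩, -⟩, -, hu, -, hull⟩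
    obtain ⟨v, hv⟩ := initials_nonempty hx
    refine ⟨v, ?_⟩
    have hmem : cutRay v ∈ braidFace x ∩ sumZeroSphere n :=
      ⟨cutRay_mem_braidFace hv, cutRay_mem_sumZeroSphere v⟩
    rw [hull] at hmem
    obtain ⟨⟨-, hnorm⟩, c, hc, hcv⟩ := hmem
    simp only [Finset.mem_singleton, forall_eq, Finset.sum_singleton] at hc hcv hu
    rw [hcv, norm_smul, hu.2, mul_one, Real.norm_of_nonneg hc] at hnorm
    rw [hnorm, one_smul] at hcv
    exact hcv

/-! ### The geometric realization -/

open Classical in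
/-- The vertices at which a point of the geometric realization has a nonzero coordinate. -/
noncomputable def carrierFace {α : Type*} [Fintype α] (w : α → ℝ) : Finset α :=
  Finset.univ.filter fun v => w v ≠ 0

theorem mem_carrierFace {α : Type*} [Fintype α] {w : α → ℝ} {v : α} :
    v ∈ carrierFace w ↔ w v ≠ 0 := by
  simp [carrierFace]

theorem sum_carrierFace {α : Type*} [Fintype α] (w : α → ℝ) :
    ∑ v ∈ carrierFace w, w v = ∑ v, w v := by
  classical
  rw [carrierFace, Finset.sum_filter_of_ne fun _ _ h => h]

theorem mem_geometricRealization {α : Type*} [Fintype α] {K : PreAbstractSimplicialComplex α}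
    {w : α → ℝ} : w ∈ geometricRealization K ↔
      (∀ v, 0 ≤ w v) ∧ ∑ v, w v = 1 ∧ carrierFace w ∈ K.faces := by
  constructor
  · rintro ⟨s, hs, h0, hout, hsum⟩
    have hsub : carrierFace w ⊆ s := fun v hv =>
      by_contra fun h => mem_carrierFace.1 hv (hout v h)
    have h1 : ∑ v, w v = 1 := by
      rw [← hsum]
      exact (Finset.sum_subset (Finset.subset_univ s) fun v _ hv => hout v hv).symm
    refine ⟨h0, h1, (K.isRelLowerSet_faces hs).2 hsub ?_⟩
    rw [Finset.nonempty_iff_ne_empty]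
    intro h
    rw [← sum_carrierFace, h, Finset.sum_empty] at h1
    exact zero_ne_one h1
  · rintro ⟨h0, h1, hK⟩
    exact ⟨_, hK, h0, fun v hv => not_not.1 fun h => hv (mem_carrierFace.2 h),
      (sum_carrierFace w).trans h1⟩

theorem isCompact_geometricRealization {α : Type*} [Fintype α]
    (K : PreAbstractSimplicialComplex α) : IsCompact (geometricRealization K) := by
  refine (isCompact_Icc (a := (0 : α → ℝ)) (b := 1)).of_isClosed_subset ?_ ?_
  · have : geometricRealization K = ⋃ s ∈ K.faces,
        {w | (∀ v, 0 ≤ w v) ∧ (∀ v ∉ s, w v = 0) ∧ ∑ v ∈ s, w v = 1} := by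
      ext w
      simp only [geometricRealization, Set.mem_iUnion, Set.mem_ofPred_eq, exists_prop]
    rw [this]
    refine (Set.toFinite K.faces).isClosed_biUnion fun s _ => ?_
    refine IsClosed.inter (s₁ := {w : α → ℝ | ∀ v, 0 ≤ w v}) ?_
      (IsClosed.inter (s₁ := {w : α → ℝ | ∀ v ∉ s, w v = 0}) ?_ ?_)
    · simp only [Set.ofPred_forall]
      exact isClosed_iInter fun v => isClosed_le continuous_const (continuous_apply v)
    · simp only [Set.ofPred_forall]
      exact isClosed_iInter fun v => isClosed_iInter fun _ =>
        isClosed_eq (continuous_apply v) continuous_const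
    · exact isClosed_eq (by fun_prop) continuous_const
  · intro w hw
    obtain ⟨h0, h1, -⟩ := mem_geometricRealization.1 hw
    refine ⟨h0, fun v => ?_⟩
    rw [Pi.one_apply, ← h1]
    exact Finset.single_le_sum (fun v _ => h0 v) (Finset.mem_univ v)

/-! ### The homeomorphism with the sphere -/

/-- The linear combination of rays with the given coefficients. -/
noncomputable def rayCombination {n : ℕ} (w : TwoBlock n → ℝ) : EuclideanSpace ℝ (Fin n) :=
  ∑ v, w v • cutRay v

theorem rayCombination_eq {n : ℕ} (w : TwoBlock n → ℝ) :
    rayCombination w = ∑ v ∈ carrierFace w, w v • cutRay v := by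
  refine (Finset.sum_subset (Finset.subset_univ _) fun v _ hv => ?_).symm
  rw [mem_carrierFace, not_not] at hv
  rw [hv, zero_smul]

theorem continuous_rayCombination (n : ℕ) : Continuous (rayCombination (n := n)) := by
  unfold rayCombination
  fun_prop

theorem normalize_rayCombination {n : ℕ} {w : TwoBlock n → ℝ}
    (hw : w ∈ geometricRealization (orderedPartitionComplex n)) :
    0 < ‖rayCombination w‖ ∧ ‖rayCombination w‖⁻¹ • rayCombination w ∈ sumZeroSphere n ∧
      initials (‖rayCombination w‖⁻¹ • rayCombination w) = carrierFace w := by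
  obtain ⟨h0, -, hK⟩ := mem_geometricRealization.1 hw
  obtain ⟨hne, hc⟩ := mem_orderedPartitionComplex.1 hK
  rw [rayCombination_eq]
  exact hc.normalize_mem hne fun v hv => (h0 v).lt_of_ne' (mem_carrierFace.1 hv)

/-- The radial projection of the complex of ordered set partitions to the sphere. -/
noncomputable def toSphere {n : ℕ} (w : geometricRealization (orderedPartitionComplex n)) :
    sumZeroSphere n :=
  ⟨‖rayCombination w.1‖⁻¹ • rayCombination w.1, (normalize_rayCombination w.2).2.1⟩

theorem initials_toSphere {n : ℕ} (w : geometricRealization (orderedPartitionComplex n)) :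
    initials (toSphere w).1 = carrierFace w.1 :=
  (normalize_rayCombination w.2).2.2

theorem continuous_toSphere (n : ℕ) : Continuous (toSphere (n := n)) := by
  have h : Continuous fun w : geometricRealization (orderedPartitionComplex n) =>
      rayCombination w.1 := (continuous_rayCombination n).comp continuous_subtype_val
  exact ((h.norm.inv₀ fun w => (normalize_rayCombination w.2).1.ne').smul h).subtype_mk _

theorem toSphere_injective (n : ℕ) : Function.Injective (toSphere (n := n)) := by
  intro w w' h
  have hface : carrierFace w.1 = carrierFace w'.1 := by
    rw [← initials_toSphere, ← initials_toSphere, h]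
  have hchain : IsBlockChain (carrierFace w.1) := by
    rw [← initials_toSphere]
    exact isBlockChain_initials _
  have ha := inv_pos.2 (normalize_rayCombination w.2).1
  have hval : ‖rayCombination w.1‖⁻¹ • rayCombination w.1 =
      ‖rayCombination w'.1‖⁻¹ • rayCombination w'.1 := congrArg Subtype.val h
  generalize ‖rayCombination w.1‖⁻¹ = a at hval ha
  generalize ‖rayCombination w'.1‖⁻¹ = b at hval
  rw [rayCombination_eq, rayCombination_eq, ← hface, Finset.smul_sum, Finset.smul_sum] at hval
  simp only [smul_smul] at hval
  have hcoeff : ∀ v, a * w.1 v = b * w'.1 v := by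
    intro v
    by_cases hv : v ∈ carrierFace w.1
    · exact hchain.coeff_eq hval v hv
    · have hv' := hv
      rw [hface] at hv'
      rw [mem_carrierFace, not_not] at hv hv'
      rw [hv, hv', mul_zero, mul_zero]
  have hab : a = b := by
    have h1 := (mem_geometricRealization.1 w.2).2.1
    have h2 := (mem_geometricRealization.1 w'.2).2.1
    rw [← mul_one a, ← mul_one b, ← h1, Finset.mul_sum, Finset.sum_congr rfl fun v _ => hcoeff v,
      ← Finset.mul_sum, h1, h2]
  subst hab
  exact Subtype.ext (funext fun v => mul_left_cancel₀ ha.ne' (hcoeff v))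

theorem toSphere_surjective (n : ℕ) : Function.Surjective (toSphere (n := n)) := by
  classical
  rintro ⟨x, hx⟩
  obtain ⟨c, hc, hcx⟩ := exists_eq_sum_cutRay hx.1
  have hC : 0 < ∑ v ∈ initials x, c v := Finset.sum_pos hc (initials_nonempty hx)
  set C := ∑ v ∈ initials x, c v
  set w : TwoBlock n → ℝ := fun v => if v ∈ initials x then C⁻¹ * c v else 0 with hw
  have hface : carrierFace w = initials x := by
    ext v
    rw [mem_carrierFace, hw]
    by_cases h : v ∈ initials x
    · simp [h, hC.ne', (hc v h).ne']
    · simp [h]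
  have hcomb : rayCombination w = C⁻¹ • x := by
    rw [rayCombination_eq, hface]
    conv_rhs => rw [hcx]
    rw [Finset.smul_sum]
    refine Finset.sum_congr rfl fun v hv => ?_
    rw [hw, smul_smul]
    simp [hv]
  refine ⟨⟨w, mem_geometricRealization.2 ⟨fun v => ?_, ?_, ?_⟩⟩, Subtype.ext ?_⟩
  · rw [hw]
    dsimp only
    split_ifs with h
    · exact mul_nonneg (inv_nonneg.2 hC.le) (hc v h).le
    · exact le_rfl
  · rw [← sum_carrierFace, hface, Finset.sum_congr rfl fun v hv => if_pos hv, ← Finset.mul_sum,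
      inv_mul_cancel₀ hC.ne']
  · rw [hface, mem_orderedPartitionComplex]
    exact ⟨initials_nonempty hx, isBlockChain_initials x⟩
  · change ‖rayCombination w‖⁻¹ • rayCombination w = x
    rw [hcomb, norm_smul, hx.2, mul_one, Real.norm_of_nonneg (inv_nonneg.2 hC.le), inv_inv,
      smul_smul, mul_inv_cancel₀ hC.ne', one_smul]

/-- The radial projection is a homeomorphism onto the sphere. -/
noncomputable def sphereHomeomorph (n : ℕ) :
    geometricRealization (orderedPartitionComplex n) ≃ₜ sumZeroSphere n :=
  haveI := isCompact_iff_compactSpace.1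
    (isCompact_geometricRealization (orderedPartitionComplex n))
  Continuous.homeoOfEquivCompactToT2
    (f := Equiv.ofBijective toSphere ⟨toSphere_injective n, toSphere_surjective n⟩)
    (continuous_toSphere n)

theorem sphereHomeomorph_image {n : ℕ} {H : Hypergraph (Fin n)}
    (hH : ∀ e ∈ H.edgeSet, e.Nonempty) :
    sphereHomeomorph n '' {p | p.1 ∈ geometricRealization (coloringComplex H)} =
      {u | u.1 ∈ hypergraphArrangement H} := by
  have key : ∀ p : geometricRealization (orderedPartitionComplex n),
      p.1 ∈ geometricRealization (coloringComplex H) ↔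
        (sphereHomeomorph n p).1 ∈ hypergraphArrangement H := by
    intro p
    obtain ⟨h0, h1, -⟩ := mem_geometricRealization.1 p.2
    rw [← initials_mem_coloringComplex hH (sphereHomeomorph n p).2, mem_geometricRealization,
      show initials (sphereHomeomorph n p).1 = carrierFace p.1 from initials_toSphere p]
    simp only [h1, true_and, and_iff_right_iff_imp]
    exact fun _ => h0
  ext u
  constructor
  · rintro ⟨p, hp, rfl⟩
    exact (key p).1 hp
  · intro hu
    obtain ⟨p, rfl⟩ := (sphereHomeomorph n).surjective u
    exact ⟨p, (key p).2 hu, rfl⟩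

theorem nonempty_of_two_le_ncard {α : Type*} {e : Set α} (h : 2 ≤ e.ncard) : e.Nonempty :=
  Set.nonempty_of_ncard_ne_zero (by omega)

theorem mainTheorem4 {n : ℕ} (H : Hypergraph (Fin n))
    (hV : H.vertexSet = Set.univ)
    (hloop : ∀ e ∈ H.edgeSet, 2 ≤ e.ncard)
    (hanti : IsAntichain (· ⊆ ·) H.edgeSet) :
    -- every cell of the restriction of the braid subdivision is a spherical simplex, and the
    -- resulting simplicial complex is isomorphic to the coloring complex
    ((∀ C ∈ restrictedBraidCells (hypergraphArrangement H), ∃ s, IsSphericalSimplex s C) ∧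
      SimpliciallyIsomorphic (coloringComplex H)
        (restrictedBraidComplex (hypergraphArrangement H))) ∧
    -- the coloring complexes are subcomplexes of the complex of all ordered set partitions, which
    -- is the barycentric subdivision of the boundary of a simplex
    (SimpliciallyIsomorphic (orderedPartitionComplex n) (sdBoundarySimplex n) ∧
      coloringComplex H ≤ coloringComplex (completeGraphHypergraph n) ∧
      coloringComplex (completeGraphHypergraph n) ≤ orderedPartitionComplex n) ∧
    -- homeomorphism with the sphere that matches the subcomplexes with the arrangements
    ∃ Φ : geometricRealization (orderedPartitionComplex n) ≃ₜ sumZeroSphere n,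
      Φ '' {p | p.1 ∈ geometricRealization (coloringComplex H)} =
          {u | u.1 ∈ hypergraphArrangement H} ∧
      Φ '' {p | p.1 ∈ geometricRealization (coloringComplex (completeGraphHypergraph n))} =
          {u | u.1 ∈ hypergraphArrangement (completeGraphHypergraph n)} := by
  have hH : ∀ e ∈ H.edgeSet, e.Nonempty := fun e he => nonempty_of_two_le_ncard (hloop e he)
  refine ⟨⟨?_, coloringComplex_iso_restrictedBraidComplex hH⟩,
    ⟨orderedPartitionComplex_iso_sdBoundarySimplex n, coloringComplex_le_completeGraph H hloop,
      coloringComplex_le_orderedPartitionComplex _⟩,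
    sphereHomeomorph n, sphereHomeomorph_image hH, sphereHomeomorph_image fun e he =>
      nonempty_of_two_le_ncard (ge_of_eq he)⟩
  rintro _ ⟨⟨x, hx, rfl⟩, -⟩
  exact ⟨_, isSphericalSimplex_initials hx⟩
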